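/- Let $G=(V,E)$ be a finite undirected graph with root $r\in V$, vertex costs $c(v)\ge 0$ and penalties $\pi(v)\ge 0$. A vertex is \emph{cheap} if $c(v)\le\pi(v)$ and \emph{expensive} otherwise. Let $\bar c(v)=0$, $\bar\pi(v)=\pi(v)-c(v)$ for cheap $v$, and $\bar c(v)=c(v)-\pi(v)$, $\bar\pi(v)=0$ for expensive $v$. For $S\subseteq V$, $\Gamma(S)$ is the set of vertices outside $S$ with a neighbour in $S$. Consider the following primal-dual algorithm for the node-weighted prize-collecting Steiner tree problem; choices left open are made arbitrarily. \textbf{Phases.} At first, the root tree $T_r$ is the vertex set of the component containing $r$ of the graph induced by $r$ and the cheap vertices, and the family $\mathcal C$ of \emph{initial components} consists of its other components. A phase starts at time $\tau=0$ with $y=0$, the family of active sets $\mathcal A=\mathcal C$ and the family of inactive sets $\mathcal I=\emptyset$. Let $\mathcal S$ be the family of all sets that have so far in the phase been in $\mathcal A\cup\mathcal I$. The \emph{age} of $C\in\mathcal C$ is the first time at which $C$ is part of an inactive set, if this has happened, and $\tau$ otherwise. The \emph{core} of $S\in\mathcal S$ is the initial component of largest age contained in $S$. All $y_S$ with $S\in\mathcal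 A$ (and $\tau$) grow at unit rate until the next event: [A] $\sum_{R\subseteq S}y_R=\sum_{v\in S}\bar\pi(v)$ for some $S\in\mathcal A$. All such $S$ move from $\mathcal A$ to $\mathcal I$. (In case of ties these events precede those of type [B].) [B] $\sum_{S:\,v\in\Gamma(S)}y_S=\bar c(v)$ for some vertex $v$ that lies in no set of $\mathcal A\cup\mathcal I$ and neighbours a set of $\mathcal A$. Choose such a vertex $\tilde v$, let $\mathcal N$ be the family of the sets $S\in\mathcal A\cup\mathcal I$ with $\tilde v\in\Gamma(S)$, and let $\mathcal L(\tilde v)$ be the set of the cores of all $S\in\mathcal S$ with $\tilde v\in\Gamma(S)$. If $\tilde v\notin\Gamma(T_r)$ and $\sum_{C\in\mathcal L(\tilde v)}\mathrm{age}(C)<\frac32\tau$, then the sets in $\mathcal N$ are removed from $\mathcal A$ and $\mathcal I$ and the single set $\{\tilde v\}\cup\bigcup\mathcal N$ is added to $\mathcal A$. Otherwise dual growth stops, a phase tree (given by its vertex set) $T=\{\tilde v\}$ is started, and $\mathtt{FindSubTree}(S,\{\tilde v\})$ is called for each $S\in\mathcal N$; then all $C\in\mathcal C$ with $C\subseteq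 T$ are removed from $\mathcal C$, $T_r$ is replaced by $T_r\cup T$ if $T\cap\Gamma(T_r)\ne\emptyset$, while otherwise $T$ is added to $\mathcal C$, and the next phase starts. If $\mathcal A=\emptyset$, the algorithm returns $T_r$. \textbf{Auxiliary graphs.} For a set $S$ and additional vertices $X$, the graph $H_S$ is obtained from $G[S\cup X]$ by contracting each inclusion-wise maximal set among the proper subsets of $S$ that have become inactive in the phase to a \emph{super-vertex}; the other vertices are \emph{original}. Super-vertices and vertices of $\mathrm{core}(S)$ cost $0$; any other vertex $v$ costs $\sum y_R$, summed over the $R\in\mathcal S$ with $R\subseteq S$, $v\in\Gamma(R)$, $\mathrm{core}(R)=\mathrm{core}(S)$. The cost of a path is the sum of the costs of its nodes. A super-vertex $R$ belongs to $T$ if $R\cap T\neq\emptyset$. $\mathtt{FindSubTree}(S,L)$: if $|L|=1$ let $P=L$; if $L=\{a,b\}$ with $a\neq b$, let $P$ be a minimum-cost $a,b$-path in $H_S$ (with $X=L$). Add the original vertices of $P$ to $T$. For each super-vertex $R$ of $H_S$ such that the set $L_R$ of the original vertices of $P$ in $\Gamma(R)$ is non-empty, call $\mathtt{FindSubTree}(R,L_R)$.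 Then choose $z\in\mathrm{core}(S)$, call $\mathtt{ConnectVertex}(S,z)$, and add $\mathrm{core}(S)$ to $T$. $\mathtt{ConnectVertex}(S,z)$: let $\hat T$ be the current $T$, and let $Q$ be a minimum-cost path from $z$ to $\hat T$ in $H_S$ (with $X=\{z\}\cup\hat T$) among those that meet $\hat T$ in their last node only. If $Q$ ends in a super-vertex $R$ and $z'$ is the original vertex preceding it, call $\mathtt{ConnectVertex}(R,z')$. Add the original vertices of $Q$ to $T$. For each super-vertex $R$ of $H_S$ with $R\cap\hat T=\emptyset$ such that the set $L_R$ of the original vertices of $Q$ in $\Gamma(R)$ is non-empty, call $\mathtt{FindSubTree}(R,L_R)$. A set $C\subseteq V$ is \emph{charged} whenever $\mathtt{FindSubTree}$ is called on a set $S$ whose core (in the current phase) is $C$. \textbf{Lemma.} In every (complete or partial) execution of the algorithm, every set $C\subseteq V$ is charged at most once over all phases together; i.e., $\mathtt{FindSubTree}$ is called at most once on a set $S$ whose core is $C$. -/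

import Mathlib

/-!
The primal-dual algorithm for the rooted node-weighted prize-collecting Steiner tree problem,
as a nondeterministic transition system. Every choice that the algorithm leaves open (ties between
tight vertices, ties between shortest paths, the vertex of the core, the order of a `for` loop) is
a choice of the transition relation.
-/

namespace NWPCST

/-- An instance: an undirected graph with a root, and non-negative vertex costs and penalties. -/
structure Instance (V : Type*) where
  graph : SimpleGraph V
  root : V
  cost : V → ℝ
  penalty : V → ℝ
  cost_nonneg : ∀ v, 0 ≤ cost v
  penalty_nonneg : ∀ v, 0 ≤ penalty v

/-- The data of a phase at one moment of the dual growing process. `comps` are the initial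
components of the phase and `rootTree` is the vertex set of the tree containing the root (both are
fixed during a phase), `time` is the time `τ`, `y` the dual solution, `active` and `inactive` the
current families of active and of maximal inactive sets, `family` all sets that have been in
one of these two families so far, `everInactive` all sets that have become inactive so far,
`age C` the age of the initial component `C` at the current time. -/
structure Phase (V : Type*) where
  comps : Finset (Finset V)
  rootTree : Finset V
  time : ℝ
  y : Finset V → ℝ
  active : Finset (Finset V)
  inactive : Finset (Finset V)
  family : Finset (Finset V)
  everInactive : Finset (Finset V)
  age : Finset V → ℝ

/-- A call `FindSubTree(set, terminals)`, together with the (final) data of the phase in which it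
is made. -/
structure Call (V : Type*) where
  phase : Phase V
  set : Finset V
  terminals : Finset V

/-- Pending work during the construction of the phase tree: a call of `FindSubTree`, the body of
such a call, a call of `ConnectVertex`, and the instruction to add vertices to the phase tree. -/
inductive Task (V : Type*) where
  | findSubTree (S L : Finset V)
  | findSubTreeBody (S L : Finset V)
  | connectVertex (S : Finset V) (z : V)
  | addVertices (X : Finset V)

/-- The algorithm is growing duals, or building the phase tree (whose vertex set so far is `T`; the
stack lists the pending tasks), or has returned the vertex set `T`. -/
inductive Config (V : Type*) where
  | growing (p : Phase V)
  | building (p : Phase V) (T : Finset V) (stack : List (Task V))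
  | finished (T : Finset V)

/-- `order` lists every element of `F` exactly once. -/
def Enumerates {α : Type*} (order : List α) (F : Finset α) : Prop :=
  order.Nodup ∧ ∀ a, a ∈ order ↔ a ∈ F

noncomputable section

variable {V : Type*} [Fintype V] [DecidableEq V]

namespace Instance

variable (I : Instance V)

/-- A vertex is cheap if its cost is at most its penalty, and expensive otherwise. -/
def Cheap (v : V) : Prop := I.cost v ≤ I.penalty v

open scoped Classical in
/-- Reduced cost. -/
def redCost (v : V) : ℝ := if I.Cheap v then 0 else I.cost v - I.penalty v

open scoped Classical in
/-- Reduced penalty. -/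
def redPenalty (v : V) : ℝ := if I.Cheap v then I.penalty v - I.cost v else 0

open scoped Classical in
/-- `Γ(S)`: the vertices outside `S` that have a neighbour in `S`. -/
def nbhd (S : Finset V) : Finset V :=
  Finset.univ.filter fun v => v ∉ S ∧ ∃ u ∈ S, I.graph.Adj u v

/-- The root and the cheap vertices. -/
def cheapOrRoot : Set V := {v | v = I.root ∨ I.Cheap v}

open scoped Classical in
/-- The components, not containing the root, of the graph induced by the root and the cheap
vertices. -/
def initialComps : Finset (Finset V) :=
  Finset.univ.filter fun S => I.root ∉ S ∧
    ∃ K : (I.graph.induce I.cheapOrRoot).ConnectedComponent, (S : Set V) = Subtype.val '' K.supp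

open scoped Classical in
/-- The component containing the root of the graph induced by the root and the cheap vertices. -/
def initialRootTree : Finset V :=
  Finset.univ.filter fun v => ∃ hv : v ∈ I.cheapOrRoot,
    (I.graph.induce I.cheapOrRoot).Reachable ⟨I.root, Or.inl rfl⟩ ⟨v, hv⟩

end Instance

namespace Phase

/-- The beginning of a phase: all initial components are active, and all duals are `0`. -/
def start (comps : Finset (Finset V)) (rootTree : Finset V) : Phase V where
  comps := comps
  rootTree := rootTree
  time := 0
  y := fun _ => 0
  active := comps
  inactive := ∅
  family := comps
  everInactive := ∅
  age := fun _ => 0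

variable (I : Instance V) (p : Phase V)

/-- `C` is the core of `S`: it has the largest age among all initial components contained
in `S`. -/
def IsCore (S C : Finset V) : Prop :=
  C ∈ p.comps ∧ C ⊆ S ∧ ∀ D ∈ p.comps, D ⊆ S → p.age D ≤ p.age C

/-- The total dual `∑_{S : v ∈ Γ(S)} y_S` that loads `v`. -/
def load (v : V) : ℝ := by
  classical exact ∑ S ∈ Finset.univ.filter (fun S : Finset V => v ∈ I.nbhd S), p.y S

/-- The slack of the penalty constraint of `S`. -/
def slack (S : Finset V) : ℝ := ∑ v ∈ S, I.redPenalty v - ∑ R ∈ S.powerset, p.y R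

open scoped Classical in
/-- The active sets that neighbour `v`. -/
def activeNbrs (v : V) : Finset (Finset V) := p.active.filter fun S => v ∈ I.nbhd S

open scoped Classical in
/-- The active and maximal inactive sets that neighbour `v`. These two families consist of
pairwise disjoint sets, so that all of them are inclusion-wise maximal. -/
def maxNbrs (v : V) : Finset (Finset V) := (p.active ∪ p.inactive).filter fun S => v ∈ I.nbhd S

/-- `v` lies in no active or inactive set, and neighbours an active one. -/
def Candidate (v : V) : Prop :=
  (∀ S ∈ p.active ∪ p.inactive, v ∉ S) ∧ (p.activeNbrs I v).Nonempty

/-- The time after which the cost constraint of the candidate `v` becomes tight. -/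
def wait (v : V) : ℝ := (I.redCost v - p.load I v) / (p.activeNbrs I v).card

open scoped Classical in
/-- Raise the duals of all active sets by `ε`. The age of an initial component is the current time
as long as it has not been part of an inactive set, and is frozen from then on. -/
def grow (ε : ℝ) : Phase V :=
  { p with
    time := p.time + ε
    y := fun S => if S ∈ p.active then p.y S + ε else p.y S
    age := fun C => if ∃ R ∈ p.everInactive, C ⊆ R then p.age C else p.time + ε }

open scoped Classical in
/-- The active sets whose penalty constraint is tight. -/
def tightSets : Finset (Finset V) := p.active.filter fun S => p.slack I S = 0

/-- All active sets whose penalty constraint is tight become inactive. -/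
def deactivate : Phase V :=
  { p with
    active := p.active \ p.tightSets I
    inactive := p.inactive ∪ p.tightSets I
    everInactive := p.everInactive ∪ p.tightSets I }

/-- The set consisting of `v` and of all the sets that neighbour it. -/
def mergedSet (v : V) : Finset V := insert v ((p.maxNbrs I v).biUnion id)

/-- `v` and all the sets that neighbour it are merged into one active set. -/
def merge (v : V) : Phase V :=
  { p with
    active := insert (p.mergedSet I v) (p.active \ p.maxNbrs I v)
    inactive := p.inactive \ p.maxNbrs I v
    family := insert (p.mergedSet I v) p.family }

open scoped Classical in
/-- The initial components that load `v`: the cores of the sets in the family neighbouring `v`. -/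
def loaders (v : V) : Finset (Finset V) :=
  p.comps.filter fun C => ∃ S ∈ p.family, v ∈ I.nbhd S ∧ p.IsCore S C

/-- The condition under which a tight vertex `v` starts the construction of the phase tree. -/
def Triggers (v : V) : Prop :=
  v ∈ I.nbhd p.rootTree ∨ 3 / 2 * p.time ≤ ∑ C ∈ p.loaders I v, p.age C

open scoped Classical in
/-- The super-vertices of the auxiliary graph of `S`: the inclusion-wise maximal ones among the
inactive sets properly contained in `S`. -/
def superVertices (S : Finset V) : Finset (Finset V) :=
  p.everInactive.filter fun R =>
    R ⊂ S ∧ ∀ R' ∈ p.everInactive, R' ⊂ S → R ⊆ R' → R = R'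

/-- The nodes of the auxiliary graph obtained from the subgraph induced by `S ∪ X` by identifying
the super-vertices: `inl v` is an original vertex, `inr R` is a super-vertex. -/
def IsNode (S X : Finset V) : V ⊕ Finset V → Prop
  | .inl v => v ∈ S ∪ X ∧ ∀ R ∈ p.superVertices S, v ∉ R
  | .inr R => R ∈ p.superVertices S

/-- The set of vertices of the graph that a node stands for. -/
def nodeSet : V ⊕ Finset V → Finset V
  | .inl v => {v}
  | .inr R => R

/-- The auxiliary graph of `S`, with the additional vertices `X`. -/
def auxGraph (S X : Finset V) : SimpleGraph (V ⊕ Finset V) where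
  Adj a b := a ≠ b ∧ p.IsNode S X a ∧ p.IsNode S X b ∧
    ∃ u ∈ nodeSet a, ∃ w ∈ nodeSet b, I.graph.Adj u w
  symm := ⟨fun _ _ ⟨hne, ha, hb, u, hu, w, hw, h⟩ => ⟨hne.symm, hb, ha, w, hw, u, hu, h.symm⟩⟩
  loopless := ⟨fun _ h => h.1 rfl⟩

open scoped Classical in
/-- The auxiliary cost with respect to the set `S` with core `C`: the dual load that an original
vertex outside `C` feels from `C`. (A set with core `C` is not raised after the time `age C`, so
that the final duals are those at this time.) -/
def auxCost (S C : Finset V) : V ⊕ Finset V → ℝ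
  | .inl v => if v ∈ C then 0 else
      ∑ R ∈ p.family.filter (fun R => R ⊆ S ∧ v ∈ I.nbhd R ∧ p.IsCore R C), p.y R
  | .inr _ => 0

/-- The total auxiliary cost of the nodes of a walk. -/
def walkCost {S C X : Finset V} {a b : V ⊕ Finset V} (w : (p.auxGraph I S X).Walk a b) : ℝ :=
  (w.support.map (p.auxCost I S C)).sum

open scoped Classical in
/-- The original vertices on a walk. -/
def origVertices {H : SimpleGraph (V ⊕ Finset V)} {a b : V ⊕ Finset V} (w : H.Walk a b) :
    Finset V :=
  Finset.univ.filter fun v => Sum.inl v ∈ w.support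

/-- `X` is the set of original vertices on the path `P` computed by `FindSubTree(S, L)`. If `L` has
one element then `P = L`; if `L = {a, b}` then `P` is a minimum-cost path from `a` to `b` in the
auxiliary graph. -/
def IsTerminalPath (S C L X : Finset V) : Prop :=
  (∃ a, L = {a} ∧ X = {a}) ∨
  ∃ a b, a ≠ b ∧ L = {a, b} ∧ ∃ w : (p.auxGraph I S L).Walk (.inl a) (.inl b),
    w.IsPath ∧
    (∀ w' : (p.auxGraph I S L).Walk (.inl a) (.inl b), w'.IsPath →
      p.walkCost I (C := C) w ≤ p.walkCost I (C := C) w') ∧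
    X = origVertices w

/-- A node belongs to the phase tree `T`, where a super-vertex does if it intersects `T`. -/
def InTree (T : Finset V) : V ⊕ Finset V → Prop
  | .inl v => v ∈ T
  | .inr R => (R ∩ T).Nonempty

/-- `w` is a path from `z` to `T` in the auxiliary graph: it meets `T` in its last node only. -/
def IsPathToTree (S T : Finset V) (z : V) (t : V ⊕ Finset V)
    (w : (p.auxGraph I S (insert z T)).Walk (.inl z) t) : Prop :=
  w.IsPath ∧ InTree T t ∧ ∀ x ∈ w.support, InTree T x → x = t

/-- `w` is a path from `z` to `T` in the auxiliary graph of minimum auxiliary cost. -/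
def IsMinPathToTree (S C T : Finset V) (z : V) (t : V ⊕ Finset V)
    (w : (p.auxGraph I S (insert z T)).Walk (.inl z) t) : Prop :=
  p.IsPathToTree I S T z t w ∧
  ∀ (t' : V ⊕ Finset V) (w' : (p.auxGraph I S (insert z T)).Walk (.inl z) t'),
    p.IsPathToTree I S T z t' w' → p.walkCost I (C := C) w ≤ p.walkCost I (C := C) w'

open scoped Classical in
/-- The super-vertices of the auxiliary graph of `S` that neighbour a vertex of `X`. -/
def superNbrs (S X : Finset V) : Finset (Finset V) :=
  (p.superVertices S).filter fun R => (X ∩ I.nbhd R).Nonempty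

open scoped Classical in
/-- Those of them that do not intersect the phase tree `T`. -/
def freeSuperNbrs (S T X : Finset V) : Finset (Finset V) :=
  (p.superNbrs I S X).filter fun R => Disjoint R T

open scoped Classical in
/-- The phase that follows a phase with phase tree `T`: the initial components connected by `T` are
removed; `T` is added to the root tree if it has a vertex adjacent to the root tree, and is a new
initial component otherwise. -/
def next (T : Finset V) : Phase V :=
  if (T ∩ I.nbhd p.rootTree).Nonempty then
    start (p.comps.filter fun C => ¬ C ⊆ T) (p.rootTree ∪ T)
  else
    start (insert T (p.comps.filter fun C => ¬ C ⊆ T)) p.rootTree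

end Phase

/-- The calls of `FindSubTree` for the sets in `order`, each with the vertices of `X` that
neighbour the set. -/
def subCalls (I : Instance V) (X : Finset V) (order : List (Finset V)) : List (Task V) :=
  order.map fun R => .findSubTree R (X ∩ I.nbhd R)

/-- If a path to the tree ends in a super-vertex `R`, then `ConnectVertex` is called for `R` and
for the original vertex that precedes `R` on the path. -/
inductive Continuation {H : SimpleGraph (V ⊕ Finset V)} {a : V ⊕ Finset V} :
    (t : V ⊕ Finset V) → H.Walk a t → List (Task V) → Prop
  | vertex (v : V) (w : H.Walk a (.inl v)) : Continuation (.inl v) w []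
  | super (R : Finset V) (w : H.Walk a (.inr R)) (z : V) (hz : w.penultimate = .inl z) :
      Continuation (.inr R) w [.connectVertex R z]

/-- `Step I c l c'`: the algorithm moves from `c` to `c'`, and `l` is the list (of length at most
one) of the calls of `FindSubTree` that this move enters. -/
inductive Step (I : Instance V) : Config V → List (Call V) → Config V → Prop
  /-- No active set is left: the algorithm terminates. -/
  | finish (p : Phase V) (h : p.active = ∅) :
      Step I (.growing p) [] (.finished p.rootTree)
  /-- The next event is that a penalty constraint becomes tight. -/
  | deactivate (p : Phase V) (S : Finset V) (hS : S ∈ p.active)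
      (hmin : ∀ R ∈ p.active, p.slack I S ≤ p.slack I R)
      (hle : ∀ v, p.Candidate I v → p.slack I S ≤ p.wait I v) :
      Step I (.growing p) [] (.growing ((p.grow (p.slack I S)).deactivate I))
  /-- The next event is that a cost constraint becomes tight, and the phase goes on. -/
  | merge (p : Phase V) (v : V) (hv : p.Candidate I v)
      (hmin : ∀ u, p.Candidate I u → p.wait I v ≤ p.wait I u)
      (hlt : ∀ R ∈ p.active, p.wait I v < p.slack I R)
      (htr : ¬ (p.grow (p.wait I v)).Triggers I v) :
      Step I (.growing p) [] (.growing ((p.grow (p.wait I v)).merge I v))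
  /-- The next event is that a cost constraint becomes tight, and the construction of the phase
  tree starts. -/
  | build (p : Phase V) (v : V) (hv : p.Candidate I v)
      (hmin : ∀ u, p.Candidate I u → p.wait I v ≤ p.wait I u)
      (hlt : ∀ R ∈ p.active, p.wait I v < p.slack I R)
      (htr : (p.grow (p.wait I v)).Triggers I v)
      (order : List (Finset V)) (horder : Enumerates order (p.maxNbrs I v)) :
      Step I (.growing p) []
        (.building (p.grow (p.wait I v)) {v} (order.map fun S => .findSubTree S {v}))
  /-- `FindSubTree(S, L)` is called. -/
  | call (p : Phase V) (T S L : Finset V) (stack : List (Task V)) :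
      Step I (.building p T (.findSubTree S L :: stack)) [⟨p, S, L⟩]
        (.building p T (.findSubTreeBody S L :: stack))
  /-- The body of `FindSubTree(S, L)`: the path connecting `L` is added to the phase tree, then
  `FindSubTree` is called on the super-vertices neighbouring it, then a vertex `z` of the core is
  connected to the phase tree, and then the core is added to the phase tree. -/
  | body (p : Phase V) (T S L : Finset V) (stack : List (Task V))
      (C : Finset V) (hC : p.IsCore S C)
      (X : Finset V) (hX : p.IsTerminalPath I S C L X)
      (order : List (Finset V)) (horder : Enumerates order (p.superNbrs I S X))
      (z : V) (hz : z ∈ C) :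
      Step I (.building p T (.findSubTreeBody S L :: stack)) []
        (.building p (T ∪ X)
          (subCalls I X order ++ [.connectVertex S z, .addVertices C] ++ stack))
  /-- `ConnectVertex(S, z)`: a minimum-cost path from `z` to the phase tree is computed; if it ends
  in a super-vertex then `ConnectVertex` is called recursively; the path is added to the phase tree;
  then `FindSubTree` is called on the super-vertices neighbouring the path that were not yet in the
  phase tree. -/
  | connect (p : Phase V) (T S : Finset V) (z : V) (stack : List (Task V))
      (C : Finset V) (hC : p.IsCore S C)
      (t : V ⊕ Finset V) (w : (p.auxGraph I S (insert z T)).Walk (.inl z) t)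
      (hw : p.IsMinPathToTree I S C T z t w)
      (cont : List (Task V)) (hcont : Continuation t w cont)
      (order : List (Finset V))
      (horder : Enumerates order (p.freeSuperNbrs I S T (Phase.origVertices w))) :
      Step I (.building p T (.connectVertex S z :: stack)) []
        (.building p T (cont ++ [.addVertices (Phase.origVertices w)] ++
          subCalls I (Phase.origVertices w) order ++ stack))
  /-- Vertices are added to the phase tree. -/
  | add (p : Phase V) (T X : Finset V) (stack : List (Task V)) :
      Step I (.building p T (.addVertices X :: stack)) [] (.building p (T ∪ X) stack)
  /-- The phase tree is complete, and the next phase begins. -/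
  | endPhase (p : Phase V) (T : Finset V) :
      Step I (.building p T []) [] (.growing (p.next I T))

/-- `Run I c l`: some execution of the algorithm on the instance `I`, started at the beginning and
not necessarily complete, has reached `c`, and `l` lists the calls of `FindSubTree` made so far,
over all phases. -/
inductive Run (I : Instance V) : Config V → List (Call V) → Prop
  | init : Run I (.growing (Phase.start I.initialComps I.initialRootTree)) []
  | step {c c' : Config V} {l l' : List (Call V)} (h : Run I c l) (hs : Step I c l' c') :
      Run I c' (l ++ l')

open scoped Classical in
/-- The number of times that the set `C` is charged, that is, the number of calls of `FindSubTree`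
on a set whose core (in the phase of the call) is `C`. -/
def timesCharged (calls : List (Call V)) (C : Finset V) : ℕ :=
  calls.countP fun k => k.phase.IsCore k.set C

end

end NWPCST

set_option linter.unusedSectionVars false

/-! The proof combines an invariant of dual growth with an invariant of the construction of the
phase tree; the latter also ensures that no initial component of the next phase has been charged.

Dual growth keeps the family laminar and every core unique (`WellFormed`). The decisive event is a
merge at `v`. An active neighbour has a core of age `τ`, and the ages of all loaders sum to less
than `3τ/2`, so every other merged set is inactive and has a younger core (`merge_ages`). Hence the
merged set inherits the core of its only active part, and every other initial component in it lies
in an inactive proper subset. Therefore super-vertices avoid the core, and a set of the family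
inside `S` with a different core lies in a super-vertex of `S`. Feasibility of the duals serves only
to show that growth amounts are non-negative, so that time never decreases.

During the construction of a phase tree `T`, let `K` be the property of having been charged. Each
waiting `FindSubTree(S, L)` has `S` disjoint from `T` and from all that earlier tasks may add. For
every vertex of `T`, the cores of all family sets containing it are charged. Conversely, a charged
initial component is already inside `T`, or some task on the stack will add it, and neither that
task nor any task before it may charge it. So when `FindSubTree` is called on `S`, the core of `S`
cannot have been charged earlier (`BuildInvariant.not_charged`).

When the stack is empty, charged initial components are exactly those inside `T`, and the others are
disjoint from `T`. The set `T` is itself uncharged: every charged set lies in an initial component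
or in the root tree, whereas `T` has a vertex outside all components and contains a component not
inside the root tree. So the next phase again starts with uncharged, pairwise disjoint components
(`BuildInvariant.next`). -/

namespace NWPCST

/-! ### Dual growth: laminarity, unique cores, feasible duals -/

section Growing

variable {V : Type*} [Fintype V] [DecidableEq V]

namespace Instance

variable (I : Instance V)

theorem redCost_nonneg (v : V) : 0 ≤ I.redCost v := by
  unfold redCost
  split_ifs with h
  · exact le_rfl
  · exact sub_nonneg.2 (not_le.1 h).le

theorem redPenalty_nonneg (v : V) : 0 ≤ I.redPenalty v := by
  unfold redPenalty
  split_ifs with h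
  · exact sub_nonneg.2 h
  · exact le_rfl

theorem mem_nbhd {S : Finset V} {v : V} :
    v ∈ I.nbhd S ↔ v ∉ S ∧ ∃ u ∈ S, I.graph.Adj u v := by
  simp [nbhd]

theorem notMem_of_mem_nbhd {S : Finset V} {v : V} (h : v ∈ I.nbhd S) : v ∉ S :=
  (I.mem_nbhd.1 h).1

end Instance

namespace Phase

/-- The combinatorial invariants of dual growth. The family is laminar, every set in it has a
unique core, and all other initial components that it contains lie in inactive proper subsets. -/
structure WellFormed (p : Phase V) : Prop where
  comps_disj : ∀ C ∈ p.comps, ∀ D ∈ p.comps, C ≠ D → Disjoint C D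
  nonempty : ∀ S ∈ p.family, S.Nonempty
  comps_sub : p.comps ⊆ p.family
  active_sub : p.active ⊆ p.family
  inactive_sub : p.inactive ⊆ p.everInactive
  ever_sub : p.everInactive ⊆ p.family
  active_ever : ∀ S ∈ p.active, S ∉ p.everInactive
  max_disj : ∀ S ∈ p.active ∪ p.inactive, ∀ R ∈ p.active ∪ p.inactive, S ≠ R → Disjoint S R
  cover : ∀ R ∈ p.family, ∃ M ∈ p.active ∪ p.inactive, R ⊆ M
  laminar : ∀ S ∈ p.family, ∀ R ∈ p.family, S ⊆ R ∨ R ⊆ S ∨ Disjoint S R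
  core : ∀ S ∈ p.family, ∃ C ∈ p.comps, C ⊆ S ∧ (∀ R ∈ p.everInactive, R ⊂ S → ¬ C ⊆ R) ∧
    ∀ D ∈ p.comps, D ⊆ S → D ≠ C → p.age D < p.age C ∧ ∃ R ∈ p.everInactive, R ⊂ S ∧ D ⊆ R
  age_nonneg : ∀ C ∈ p.comps, 0 ≤ p.age C
  age_le : ∀ C ∈ p.comps, p.age C ≤ p.time
  age_eq : ∀ C ∈ p.comps, (∀ R ∈ p.everInactive, ¬ C ⊆ R) → p.age C = p.time

/-- The dual solution is feasible, and supported on the family. -/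
structure Feasible (I : Instance V) (p : Phase V) : Prop where
  y_nonneg : ∀ R, 0 ≤ p.y R
  y_support : ∀ R, R ∉ p.family → p.y R = 0
  load_le : ∀ v, (∀ S ∈ p.active ∪ p.inactive, v ∉ S) → p.load I v ≤ I.redCost v
  slack_nonneg : ∀ S ∈ p.active ∪ p.inactive, 0 ≤ p.slack I S

theorem wellFormed_start {comps : Finset (Finset V)} (T : Finset V)
    (hd : ∀ C ∈ comps, ∀ D ∈ comps, C ≠ D → Disjoint C D) (hn : ∀ C ∈ comps, C.Nonempty) :
    (start comps T).WellFormed where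
  comps_disj := hd
  nonempty := hn
  comps_sub := subset_rfl
  active_sub := subset_rfl
  inactive_sub := subset_rfl
  ever_sub := Finset.empty_subset _
  active_ever := fun _ _ h => absurd h (Finset.notMem_empty _)
  max_disj := by simpa [start] using hd
  cover := fun R hR => ⟨R, by simpa [start] using hR, subset_rfl⟩
  laminar := fun S hS R hR => by
    by_cases h : S = R
    · exact Or.inl h.subset
    · exact Or.inr (Or.inr (hd S hS R hR h))
  core := fun S hS => ⟨S, hS, subset_rfl, fun R hR => absurd hR (Finset.notMem_empty _),
    fun D hD hDS hne => by
      have h := (hd D hD S hS hne).eq_bot_of_le hDS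
      exact absurd (hn D hD) (by simp [h])⟩
  age_nonneg := fun _ _ => le_rfl
  age_le := fun _ _ => le_rfl
  age_eq := fun _ _ _ => rfl

theorem feasible_start (I : Instance V) (comps : Finset (Finset V)) (T : Finset V) :
    (start comps T).Feasible I where
  y_nonneg := fun _ => le_rfl
  y_support := fun _ _ => rfl
  load_le := fun v _ => by simpa [load, start] using I.redCost_nonneg v
  slack_nonneg := fun S _ => by
    simpa [slack, start] using Finset.sum_nonneg fun v _ => I.redPenalty_nonneg v

variable {I : Instance V} {p : Phase V}

/-! ### Combinatorial invariants of dual growth -/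

namespace WellFormed

theorem inactive_sub_family (h : p.WellFormed) : p.inactive ⊆ p.family :=
  h.inactive_sub.trans h.ever_sub

theorem max_sub_family (h : p.WellFormed) : p.active ∪ p.inactive ⊆ p.family :=
  Finset.union_subset h.active_sub h.inactive_sub_family

theorem eq_of_mem (h : p.WellFormed) {S R : Finset V} (hS : S ∈ p.active ∪ p.inactive)
    (hR : R ∈ p.active ∪ p.inactive) {v : V} (hvS : v ∈ S) (hvR : v ∈ R) : S = R := by
  by_contra hne
  exact Finset.disjoint_left.1 (h.max_disj S hS R hR hne) hvS hvR

theorem eq_of_subset (h : p.WellFormed) {S R : Finset V} (hS : S ∈ p.active ∪ p.inactive)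
    (hR : R ∈ p.active ∪ p.inactive) (hRS : R ⊆ S) : R = S := by
  obtain ⟨v, hv⟩ := h.nonempty R (h.max_sub_family hR)
  exact h.eq_of_mem hR hS hv (hRS hv)

theorem comp_eq_of_mem (h : p.WellFormed) {C D : Finset V} (hC : C ∈ p.comps)
    (hD : D ∈ p.comps) {v : V} (hvC : v ∈ C) (hvD : v ∈ D) : C = D := by
  by_contra hne
  exact Finset.disjoint_left.1 (h.comps_disj C hC D hD hne) hvC hvD

theorem exists_isCore (h : p.WellFormed) {S : Finset V} (hS : S ∈ p.family) :
    ∃ C, p.IsCore S C := by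
  obtain ⟨C, hC, hCS, -, hmax⟩ := h.core S hS
  refine ⟨C, hC, hCS, fun D hD hDS => ?_⟩
  by_cases hne : D = C
  · rw [hne]
  · exact (hmax D hD hDS hne).1.le

/-- The component supplied by the invariant is strictly older than all others in `S`, so no other
component can be a core, and its properties pass to every core. -/
theorem core_spec (h : p.WellFormed) {S C : Finset V} (hS : S ∈ p.family) (hC : p.IsCore S C) :
    (∀ R ∈ p.everInactive, R ⊂ S → ¬ C ⊆ R) ∧
    ∀ D ∈ p.comps, D ⊆ S → D ≠ C → p.age D < p.age C ∧ ∃ R ∈ p.everInactive, R ⊂ S ∧ D ⊆ R := by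
  obtain ⟨C', hC', hCS', h1, h2⟩ := h.core S hS
  by_cases hne : C = C'
  · rw [hne]; exact ⟨h1, h2⟩
  · exact absurd (hC.2.2 C' hC' hCS') (not_le.2 (h2 C hC.1 hC.2.1 hne).1)

theorem core_unique (h : p.WellFormed) {S C D : Finset V} (hS : S ∈ p.family)
    (hC : p.IsCore S C) (hD : p.IsCore S D) : D = C := by
  by_contra hne
  exact absurd (hD.2.2 C hC.1 hC.2.1) (not_le.2 ((h.core_spec hS hC).2 D hD.1 hD.2.1 hne).1)

theorem isCore_self (h : p.WellFormed) {C : Finset V} (hC : C ∈ p.comps) : p.IsCore C C := by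
  refine ⟨hC, subset_rfl, fun D hD hDC => ?_⟩
  obtain ⟨v, hv⟩ := h.nonempty D (h.comps_sub hD)
  rw [h.comp_eq_of_mem hD hC hv (hDC hv)]

/-- Active sets are maximal and were never inactive, so an inactive set around the core would be a
proper subset of `S`, which the core of `S` avoids. -/
theorem not_subset_ever_of_active (h : p.WellFormed) {S C : Finset V} (hS : S ∈ p.active)
    (hC : p.IsCore S C) : ∀ R ∈ p.everInactive, ¬ C ⊆ R := by
  intro R hR hCR
  obtain ⟨M, hM, hRM⟩ := h.cover R (h.ever_sub hR)
  obtain ⟨v, hv⟩ := h.nonempty C (h.comps_sub hC.1)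
  have hMS : M = S :=
    h.eq_of_mem hM (Finset.mem_union_left _ hS) (hRM (hCR hv)) (hC.2.1 hv)
  subst hMS
  refine (h.core_spec (h.active_sub hS) hC).1 R hR (lt_of_le_of_ne hRM ?_) hCR
  rintro rfl
  exact h.active_ever R hS hR

theorem age_of_active (h : p.WellFormed) {S C : Finset V} (hS : S ∈ p.active)
    (hC : p.IsCore S C) : p.age C = p.time :=
  h.age_eq C hC.1 (h.not_subset_ever_of_active hS hC)

theorem grow (h : p.WellFormed) {ε : ℝ} (hε : 0 ≤ ε) : (p.grow ε).WellFormed where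
  comps_disj := h.comps_disj
  nonempty := h.nonempty
  comps_sub := h.comps_sub
  active_sub := h.active_sub
  inactive_sub := h.inactive_sub
  ever_sub := h.ever_sub
  active_ever := h.active_ever
  max_disj := h.max_disj
  cover := h.cover
  laminar := h.laminar
  core := fun S hS => by
    obtain ⟨C, hC, hCS, h1, h2⟩ := h.core S hS
    refine ⟨C, hC, hCS, h1, fun D hD hDS hne => ⟨?_, (h2 D hD hDS hne).2⟩⟩
    obtain ⟨hlt, R, hR, -, hDR⟩ := h2 D hD hDS hne
    have hle : p.age C ≤ p.time := h.age_le C hC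
    simp only [Phase.grow]
    -- `D` lies in an inactive set, so its age is frozen; the age of `C` either stays or moves on to
    -- the new time, so the strict inequality survives.
    rw [if_pos ⟨R, hR, hDR⟩]
    split_ifs
    · exact hlt
    · linarith
  age_nonneg := fun C hC => by
    have h0 : 0 ≤ p.age C := h.age_nonneg C hC
    have hle : p.age C ≤ p.time := h.age_le C hC
    simp only [Phase.grow]
    split_ifs <;> linarith
  age_le := fun C hC => by
    have hle : p.age C ≤ p.time := h.age_le C hC
    simp only [Phase.grow]
    split_ifs <;> linarith
  age_eq := fun C hC hR => by
    simp only [Phase.grow]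
    rw [if_neg]
    rintro ⟨R, hR', hCR⟩
    exact hR R hR' hCR

theorem mem_tightSets {S : Finset V} :
    S ∈ p.tightSets I ↔ S ∈ p.active ∧ p.slack I S = 0 := by
  simp [tightSets]

theorem deactivate_union :
    (p.deactivate I).active ∪ (p.deactivate I).inactive = p.active ∪ p.inactive := by
  ext S
  have := mem_tightSets (I := I) (p := p) (S := S)
  simp only [Phase.deactivate, Finset.mem_union, Finset.mem_sdiff]
  tauto

theorem deactivate (h : p.WellFormed) : (p.deactivate I).WellFormed where
  comps_disj := h.comps_disj
  nonempty := h.nonempty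
  comps_sub := h.comps_sub
  active_sub := Finset.sdiff_subset.trans h.active_sub
  inactive_sub := Finset.union_subset_union h.inactive_sub subset_rfl
  ever_sub := Finset.union_subset h.ever_sub fun S hS => h.active_sub (mem_tightSets.1 hS).1
  active_ever := fun S hS hS' => by
    obtain ⟨hS1, hS2⟩ := Finset.mem_sdiff.1 hS
    rcases Finset.mem_union.1 hS' with h' | h'
    · exact h.active_ever S hS1 h'
    · exact hS2 h'
  max_disj := by rw [deactivate_union]; exact h.max_disj
  cover := by rw [deactivate_union]; exact h.cover
  laminar := h.laminar
  core := fun S hS => by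
    obtain ⟨C, hC, hCS, h1, h2⟩ := h.core S hS
    refine ⟨C, hC, hCS, fun R hR hRS => ?_, fun D hD hDS hne => ?_⟩
    · rcases Finset.mem_union.1 hR with h' | h'
      · exact h1 R h' hRS
      -- A set that has just become inactive is maximal, hence a proper subset of no set of the
      -- family.
      · have hRa : R ∈ p.active ∪ p.inactive := Finset.mem_union_left _ (mem_tightSets.1 h').1
        obtain ⟨M, hM, hSM⟩ := h.cover S hS
        have hRM := h.eq_of_subset hM hRa (hRS.subset.trans hSM)
        exact absurd (hRM ▸ hSM) hRS.2
    · obtain ⟨hlt, R, hR, hRS, hDR⟩ := h2 D hD hDS hne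
      exact ⟨hlt, R, Finset.mem_union_left _ hR, hRS, hDR⟩
  age_nonneg := h.age_nonneg
  age_le := h.age_le
  age_eq := fun C hC hR => h.age_eq C hC fun R hR' => hR R (Finset.mem_union_left _ hR')

theorem mem_maxNbrs {S : Finset V} {v : V} :
    S ∈ p.maxNbrs I v ↔ S ∈ p.active ∪ p.inactive ∧ v ∈ I.nbhd S := by
  simp [maxNbrs]

theorem mem_activeNbrs {S : Finset V} {v : V} :
    S ∈ p.activeNbrs I v ↔ S ∈ p.active ∧ v ∈ I.nbhd S := by
  simp [activeNbrs]

theorem mem_mergedSet {u v : V} :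
    u ∈ p.mergedSet I v ↔ u = v ∨ ∃ N ∈ p.maxNbrs I v, u ∈ N := by
  simp [mergedSet]

theorem subset_mergedSet {N : Finset V} {v : V} (hN : N ∈ p.maxNbrs I v) :
    N ⊆ p.mergedSet I v := fun _ hu => mem_mergedSet.2 (Or.inr ⟨N, hN, hu⟩)

theorem ssubset_mergedSet {N : Finset V} {v : V} (hN : N ∈ p.maxNbrs I v) :
    N ⊂ p.mergedSet I v :=
  ⟨subset_mergedSet hN, fun hsub =>
    I.notMem_of_mem_nbhd (mem_maxNbrs.1 hN).2 (hsub (mem_mergedSet.2 (Or.inl rfl)))⟩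

theorem disjoint_mergedSet (h : p.WellFormed) {M : Finset V} {v : V}
    (hM : M ∈ p.active ∪ p.inactive) (hM' : M ∉ p.maxNbrs I v) (hv : v ∉ M) :
    Disjoint M (p.mergedSet I v) := by
  rw [Finset.disjoint_left]
  intro u hu hu'
  rcases mem_mergedSet.1 hu' with rfl | ⟨N, hN, huN⟩
  · exact hv hu
  · exact hM' (h.eq_of_mem hM (mem_maxNbrs.1 hN).1 hu huN ▸ hN)

theorem mem_merge_union {S : Finset V} {v : V} :
    S ∈ (p.merge I v).active ∪ (p.merge I v).inactive ↔
      S = p.mergedSet I v ∨ (S ∈ p.active ∪ p.inactive ∧ S ∉ p.maxNbrs I v) := by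
  simp only [Phase.merge, Finset.mem_union, Finset.mem_insert, Finset.mem_sdiff]
  tauto

theorem exists_maxNbr_of_subset_mergedSet (h : p.WellFormed) {v : V} (hv : p.Candidate I v)
    {R : Finset V} (hR : R ∈ p.family) (hRv : R ⊆ p.mergedSet I v) :
    ∃ N ∈ p.maxNbrs I v, R ⊆ N := by
  obtain ⟨M, hM, hRM⟩ := h.cover R hR
  refine ⟨M, ?_, hRM⟩
  by_contra hM'
  obtain ⟨u, hu⟩ := h.nonempty R hR
  exact Finset.disjoint_left.1 (h.disjoint_mergedSet hM hM' (hv.1 M hM)) (hRM hu) (hRv hu)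

theorem mergedSet_notMem_family (h : p.WellFormed) {v : V} (hv : p.Candidate I v) :
    p.mergedSet I v ∉ p.family := fun hmem => by
  obtain ⟨M, hM, hsub⟩ := h.cover _ hmem
  exact hv.1 M hM (hsub (mem_mergedSet.2 (Or.inl rfl)))

theorem mem_loaders {C : Finset V} {v : V} :
    C ∈ p.loaders I v ↔ C ∈ p.comps ∧ ∃ S ∈ p.family, v ∈ I.nbhd S ∧ p.IsCore S C := by
  simp [loaders]

/-- If the condition for starting the phase tree fails, then the sets that are merged with an active
set `A` are inactive, and the ages of their cores are less than that of the core of `A`. -/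
theorem merge_ages (h : p.WellFormed) {v : V} (htr : ¬ p.Triggers I v) {A C : Finset V}
    (hA : A ∈ p.activeNbrs I v) (hC : p.IsCore A C) {N D : Finset V} (hN : N ∈ p.maxNbrs I v)
    (hNA : N ≠ A) (hD : p.IsCore N D) : N ∈ p.inactive ∧ p.age D < p.age C := by
  obtain ⟨hA1, hA2⟩ := mem_activeNbrs.1 hA
  obtain ⟨hN1, hN2⟩ := mem_maxNbrs.1 hN
  have hlt : ∑ E ∈ p.loaders I v, p.age E < 3 / 2 * p.time := by
    by_contra hge
    exact htr (Or.inr (not_lt.1 hge))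
  have hCl : C ∈ p.loaders I v := mem_loaders.2 ⟨hC.1, A, h.active_sub hA1, hA2, hC⟩
  have hDl : D ∈ p.loaders I v := mem_loaders.2 ⟨hD.1, N, h.max_sub_family hN1, hN2, hD⟩
  have hne : C ≠ D := by
    rintro rfl
    obtain ⟨u, hu⟩ := h.nonempty C (h.comps_sub hC.1)
    exact hNA (h.eq_of_mem hN1 (Finset.mem_union_left _ hA1) (hD.2.1 hu) (hC.2.1 hu))
  have hsum : p.age C + p.age D ≤ ∑ E ∈ p.loaders I v, p.age E := by
    rw [← Finset.sum_pair hne]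
    refine Finset.sum_le_sum_of_subset_of_nonneg ?_ fun E hE _ =>
      h.age_nonneg E (mem_loaders.1 hE).1
    intro E hE
    rcases Finset.mem_insert.1 hE with rfl | hE
    · exact hCl
    · rw [Finset.mem_singleton.1 hE]; exact hDl
  have hCt := h.age_of_active hA1 hC
  have hC0 := h.age_nonneg C hC.1
  have hD0 := h.age_nonneg D hD.1
  -- As `C` has age `τ`, less than `τ/2` is left for `D`; non-negativity of the age of `D` gives `τ
  -- > 0`.
  have hDC : p.age D < p.age C := by linarith
  refine ⟨?_, hDC⟩
  rcases Finset.mem_union.1 hN1 with h' | h'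
  · exact absurd (h.age_of_active h' hD) (by linarith)
  · exact h'

theorem merge (h : p.WellFormed) {v : V} (hv : p.Candidate I v) (htr : ¬ p.Triggers I v) :
    (p.merge I v).WellFormed where
  comps_disj := h.comps_disj
  nonempty := fun S hS => by
    rcases Finset.mem_insert.1 hS with rfl | hS
    · exact ⟨v, mem_mergedSet.2 (Or.inl rfl)⟩
    · exact h.nonempty S hS
  comps_sub := h.comps_sub.trans (Finset.subset_insert _ _)
  active_sub := Finset.insert_subset_insert _ (Finset.sdiff_subset.trans h.active_sub)
  inactive_sub := Finset.sdiff_subset.trans h.inactive_sub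
  ever_sub := h.ever_sub.trans (Finset.subset_insert _ _)
  active_ever := fun S hS hS' => by
    rcases Finset.mem_insert.1 hS with rfl | hS
    · exact h.mergedSet_notMem_family hv (h.ever_sub hS')
    · exact h.active_ever S (Finset.mem_sdiff.1 hS).1 hS'
  max_disj := fun S hS R hR hne => by
    rcases mem_merge_union.1 hS with rfl | ⟨hS1, hS2⟩
    · rcases mem_merge_union.1 hR with rfl | ⟨hR1, hR2⟩
      · exact absurd rfl hne
      · exact (h.disjoint_mergedSet hR1 hR2 (hv.1 R hR1)).symm
    · rcases mem_merge_union.1 hR with rfl | ⟨hR1, hR2⟩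
      · exact h.disjoint_mergedSet hS1 hS2 (hv.1 S hS1)
      · exact h.max_disj S hS1 R hR1 hne
  cover := fun R hR => by
    rcases Finset.mem_insert.1 hR with rfl | hR
    · exact ⟨_, mem_merge_union.2 (Or.inl rfl), subset_rfl⟩
    · obtain ⟨M, hM, hRM⟩ := h.cover R hR
      by_cases hM' : M ∈ p.maxNbrs I v
      · exact ⟨_, mem_merge_union.2 (Or.inl rfl), hRM.trans (subset_mergedSet hM')⟩
      · exact ⟨M, mem_merge_union.2 (Or.inr ⟨hM, hM'⟩), hRM⟩
  laminar := by
    have key : ∀ R ∈ p.family, R ⊆ p.mergedSet I v ∨ Disjoint R (p.mergedSet I v) := by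
      intro R hR
      obtain ⟨M, hM, hRM⟩ := h.cover R hR
      by_cases hM' : M ∈ p.maxNbrs I v
      · exact Or.inl (hRM.trans (subset_mergedSet hM'))
      · exact Or.inr ((h.disjoint_mergedSet hM hM' (hv.1 M hM)).mono_left hRM)
    intro S hS R hR
    rcases Finset.mem_insert.1 hS with rfl | hS
    · rcases Finset.mem_insert.1 hR with rfl | hR
      · exact Or.inl subset_rfl
      · exact Or.inr ((key R hR).imp_right fun hd => hd.symm)
    · rcases Finset.mem_insert.1 hR with rfl | hR
      · exact (key S hS).imp_right Or.inr
      · exact h.laminar S hS R hR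
  core := fun S hS => by
    rcases Finset.mem_insert.1 hS with rfl | hS
    · obtain ⟨A, hA⟩ := hv.2
      obtain ⟨hA1, hA2⟩ := mem_activeNbrs.1 hA
      have hAN : A ∈ p.maxNbrs I v := mem_maxNbrs.2 ⟨Finset.mem_union_left _ hA1, hA2⟩
      obtain ⟨C, hC⟩ := h.exists_isCore (h.active_sub hA1)
      -- The core of the active neighbour `A` becomes the core. A component inside `A` is handled by
      -- the invariant for `A`; one inside another neighbour `N` is at most as old as the core of
      -- `N`, and `N` itself is the inactive set containing it.
      refine ⟨C, hC.1, hC.2.1.trans (subset_mergedSet hAN),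
        fun R hR _ => h.not_subset_ever_of_active hA1 hC R hR, fun D hD hDS hne => ?_⟩
      obtain ⟨N, hN, hDN⟩ := h.exists_maxNbr_of_subset_mergedSet hv (h.comps_sub hD) hDS
      by_cases hNA : N = A
      · subst hNA
        obtain ⟨hlt, R, hR, hRN, hDR⟩ := (h.core_spec (h.active_sub hA1) hC).2 D hD hDN hne
        exact ⟨hlt, R, hR, hRN.trans (ssubset_mergedSet hN), hDR⟩
      · obtain ⟨E, hE⟩ := h.exists_isCore (h.max_sub_family (mem_maxNbrs.1 hN).1)
        obtain ⟨hNi, hlt⟩ := h.merge_ages htr hA hC hN hNA hE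
        exact ⟨(hE.2.2 D hD hDN).trans_lt hlt, N, h.inactive_sub hNi, ssubset_mergedSet hN, hDN⟩
    · exact h.core S hS
  age_nonneg := h.age_nonneg
  age_le := h.age_le
  age_eq := h.age_eq

end WellFormed

/-! ### Feasibility of the duals -/

namespace Feasible

open WellFormed

theorem load_grow (ε : ℝ) (v : V) :
    (p.grow ε).load I v = p.load I v + (p.activeNbrs I v).card * ε := by
  classical
  have hy : ∀ S, (p.grow ε).y S = p.y S + if S ∈ p.active then ε else 0 := by
    intro S
    simp only [Phase.grow]
    split_ifs <;> simp
  simp only [load, hy, Finset.sum_add_distrib]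
  congr 1
  rw [← Finset.sum_filter, Finset.sum_const, nsmul_eq_mul]
  congr 3
  ext S
  simp [activeNbrs, and_comm]

/-- Maximal sets are disjoint and non-empty, so `S` is the only active subset of itself. -/
theorem slack_grow_active (h : p.WellFormed) {S : Finset V} (hS : S ∈ p.active) (ε : ℝ) :
    (p.grow ε).slack I S = p.slack I S - ε := by
  have hy : ∀ R ∈ S.powerset, (p.grow ε).y R = p.y R + if R = S then ε else 0 := by
    intro R hR
    have : R ∈ p.active ↔ R = S := ⟨fun hRa => h.eq_of_subset (Finset.mem_union_left _ hS)
      (Finset.mem_union_left _ hRa) (Finset.mem_powerset.1 hR), fun e => e ▸ hS⟩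
    simp only [Phase.grow, this]
    split_ifs <;> simp
  rw [slack, slack, Finset.sum_congr rfl hy, Finset.sum_add_distrib, Finset.sum_ite_eq',
    if_pos (Finset.mem_powerset_self S)]
  ring

theorem slack_grow_inactive (h : p.WellFormed) {S : Finset V} (hS : S ∈ p.inactive) (ε : ℝ) :
    (p.grow ε).slack I S = p.slack I S := by
  have hy : ∀ R ∈ S.powerset, (p.grow ε).y R = p.y R := by
    intro R hR
    have : R ∉ p.active := fun hRa => by
      have := h.eq_of_subset (Finset.mem_union_right _ hS)
        (Finset.mem_union_left _ hRa) (Finset.mem_powerset.1 hR)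
      exact h.active_ever R hRa (h.inactive_sub (this ▸ hS))
    simp only [Phase.grow, if_neg this]
  rw [slack, slack, Finset.sum_congr rfl hy]

theorem wait_nonneg (hf : p.Feasible I) {v : V} (hv : p.Candidate I v) : 0 ≤ p.wait I v :=
  div_nonneg (sub_nonneg.2 (hf.load_le v hv.1)) (Nat.cast_nonneg _)

theorem grow (h : p.WellFormed) (hf : p.Feasible I) {ε : ℝ} (hε : 0 ≤ ε)
    (hw : ∀ v, p.Candidate I v → ε ≤ p.wait I v) (hs : ∀ S ∈ p.active, ε ≤ p.slack I S) :
    (p.grow ε).Feasible I where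
  y_nonneg := fun R => by
    have h0 : 0 ≤ p.y R := hf.y_nonneg R
    simp only [Phase.grow]
    split_ifs <;> linarith
  y_support := fun R hR => by
    simp only [Phase.grow]
    rw [if_neg fun hRa => hR (h.active_sub hRa)]
    exact hf.y_support R hR
  load_le := fun v hv => by
    rw [load_grow]
    rcases (p.activeNbrs I v).eq_empty_or_nonempty with he | hne
    · simpa [he] using hf.load_le v hv
    · have hw' := hw v ⟨hv, hne⟩
      have hpos : (0 : ℝ) < (p.activeNbrs I v).card := by exact_mod_cast hne.card_pos
      rw [wait, le_div_iff₀ hpos] at hw'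
      linarith
  slack_nonneg := fun S hS => by
    by_cases hSa : S ∈ p.active
    · rw [slack_grow_active h hSa]
      exact sub_nonneg.2 (hs S hSa)
    · have hS' : S ∈ p.active ∪ p.inactive := hS
      rw [slack_grow_inactive h ((Finset.mem_union.1 hS').resolve_left hSa)]
      exact hf.slack_nonneg S hS

theorem deactivate (hf : p.Feasible I) : (p.deactivate I).Feasible I where
  y_nonneg := hf.y_nonneg
  y_support := hf.y_support
  load_le := fun v hv => by rw [deactivate_union] at hv; exact hf.load_le v hv
  slack_nonneg := by rw [deactivate_union]; exact hf.slack_nonneg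

/-- Only an inequality, since it is meant for powersets of disjoint sets, which share the empty set.
-/
theorem sum_biUnion_le_of_nonneg {α β : Type*} [DecidableEq α] [DecidableEq β] {f : β → ℝ}
    (hf : ∀ b, 0 ≤ f b) (s : Finset α) (t : α → Finset β) :
    ∑ b ∈ s.biUnion t, f b ≤ ∑ a ∈ s, ∑ b ∈ t a, f b := by
  induction s using Finset.induction_on with
  | empty => simp
  | insert a s ha ih =>
    rw [Finset.biUnion_insert, Finset.sum_insert ha]
    have h1 := Finset.sum_union_inter (s₁ := t a) (s₂ := s.biUnion t) (f := f)
    have h2 : 0 ≤ ∑ b ∈ t a ∩ s.biUnion t, f b := Finset.sum_nonneg fun b _ => hf b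
    linarith

/-- Slack is superadditive here: `v` brings a non-negative penalty, and no set with positive dual
contains `v`, so every such set inside the merged set lies in one of the merged parts. -/
theorem slack_mergedSet_nonneg (h : p.WellFormed) (hf : p.Feasible I) {v : V}
    (hv : p.Candidate I v) : 0 ≤ p.slack I (p.mergedSet I v) := by
  classical
  have hdis : ((p.maxNbrs I v : Finset (Finset V)) : Set (Finset V)).PairwiseDisjoint id :=
    fun S hS R hR hne => h.max_disj S (mem_maxNbrs.1 hS).1 R (mem_maxNbrs.1 hR).1 hne
  have hpen : ∑ N ∈ p.maxNbrs I v, ∑ u ∈ N, I.redPenalty u ≤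
      ∑ u ∈ p.mergedSet I v, I.redPenalty u := by
    have := Finset.sum_biUnion (f := I.redPenalty) hdis
    simp only [id] at this
    rw [← this]
    exact Finset.sum_le_sum_of_subset_of_nonneg (Finset.subset_insert _ _)
      fun u _ _ => I.redPenalty_nonneg u
  have hy : ∑ R ∈ (p.mergedSet I v).powerset, p.y R ≤
      ∑ N ∈ p.maxNbrs I v, ∑ R ∈ N.powerset, p.y R := by
    have hle : ∑ R ∈ (p.maxNbrs I v).biUnion Finset.powerset, p.y R ≤
        ∑ N ∈ p.maxNbrs I v, ∑ R ∈ N.powerset, p.y R :=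
      sum_biUnion_le_of_nonneg hf.y_nonneg _ _
    refine le_trans ?_ hle
    rw [← Finset.sum_filter_ne_zero]
    refine Finset.sum_le_sum_of_subset_of_nonneg (fun R hR => ?_) fun R _ _ => hf.y_nonneg R
    obtain ⟨hR, hne⟩ := Finset.mem_filter.1 hR
    have hRf : R ∈ p.family := by
      by_contra hRf
      exact hne (hf.y_support R hRf)
    obtain ⟨N, hN, hRN⟩ :=
      h.exists_maxNbr_of_subset_mergedSet hv hRf (Finset.mem_powerset.1 hR)
    exact Finset.mem_biUnion.2 ⟨N, hN, Finset.mem_powerset.2 hRN⟩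
  have hsl : 0 ≤ ∑ N ∈ p.maxNbrs I v, p.slack I N :=
    Finset.sum_nonneg fun N hN => hf.slack_nonneg N (mem_maxNbrs.1 hN).1
  simp only [slack, Finset.sum_sub_distrib] at hsl ⊢
  linarith

theorem merge (h : p.WellFormed) (hf : p.Feasible I) {v : V} (hv : p.Candidate I v) :
    (p.merge I v).Feasible I where
  y_nonneg := hf.y_nonneg
  y_support := fun R hR => hf.y_support R fun hR' => hR (Finset.mem_insert_of_mem hR')
  load_le := fun u hu => by
    refine hf.load_le u fun S hS huS => ?_
    by_cases hS' : S ∈ p.maxNbrs I v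
    · exact hu _ (mem_merge_union.2 (Or.inl rfl)) (subset_mergedSet hS' huS)
    · exact hu S (mem_merge_union.2 (Or.inr ⟨hS, hS'⟩)) huS
  slack_nonneg := fun S hS => by
    rcases mem_merge_union.1 hS with rfl | ⟨hS1, -⟩
    · exact slack_mergedSet_nonneg h hf hv
    · exact hf.slack_nonneg S hS1

end Feasible

end Phase

end Growing

/-! ### Construction of the phase tree -/

section Building

variable {V : Type*} [Fintype V] [DecidableEq V] {I : Instance V} {p : Phase V}

namespace Phase

theorem mem_superVertices {S R : Finset V} : R ∈ p.superVertices S ↔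
    R ∈ p.everInactive ∧ R ⊂ S ∧ ∀ R' ∈ p.everInactive, R' ⊂ S → R ⊆ R' → R = R' := by
  simp [superVertices]

theorem mem_superNbrs {S X R : Finset V} :
    R ∈ p.superNbrs I S X ↔ R ∈ p.superVertices S ∧ (X ∩ I.nbhd R).Nonempty := by
  simp [superNbrs]

theorem mem_freeSuperNbrs {S T X R : Finset V} :
    R ∈ p.freeSuperNbrs I S T X ↔ R ∈ p.superNbrs I S X ∧ Disjoint R T := by
  simp [freeSuperNbrs]

theorem mem_origVertices {H : SimpleGraph (V ⊕ Finset V)} {a b : V ⊕ Finset V} {w : H.Walk a b}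
    {v : V} : v ∈ origVertices w ↔ Sum.inl v ∈ w.support := by
  simp [origVertices]

/-- Adjacency certifies that both ends are nodes; a trivial walk has no edge, and its vertex need
not be a node. -/
theorem isNode_of_mem_support {S X : Finset V} {a b : V ⊕ Finset V}
    (w : (p.auxGraph I S X).Walk a b) {x : V ⊕ Finset V} (hx : x ∈ w.support) :
    p.IsNode S X x ∨ (x = a ∧ a = b) := by
  induction w with
  | nil => exact Or.inr ⟨by simpa using hx, rfl⟩
  | cons hadj w ih =>
    rw [SimpleGraph.Walk.support_cons, List.mem_cons] at hx
    rcases hx with rfl | hx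
    · exact Or.inl hadj.2.1
    · rcases ih hx with h | ⟨rfl, -⟩
      · exact Or.inl h
      · exact Or.inl hadj.2.2.1

/-- The union of the super-vertices of the auxiliary graph of `S`. -/
noncomputable def superUnion (p : Phase V) (S : Finset V) : Finset V :=
  (p.superVertices S).biUnion id

theorem mem_superUnion {S : Finset V} {v : V} :
    v ∈ p.superUnion S ↔ ∃ R ∈ p.superVertices S, v ∈ R := by
  simp [superUnion]

theorem superUnion_subset (S : Finset V) : p.superUnion S ⊆ S := fun _ hv => by
  obtain ⟨R, hR, hvR⟩ := mem_superUnion.1 hv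
  exact (mem_superVertices.1 hR).2.1.subset hvR

theorem subset_superUnion {S R : Finset V} (hR : R ∈ p.superVertices S) :
    R ⊆ p.superUnion S := fun _ hv => mem_superUnion.2 ⟨R, hR, hv⟩

theorem exists_superVertex {S R : Finset V} (hR : R ∈ p.everInactive) (hRS : R ⊂ S) :
    ∃ R' ∈ p.superVertices S, R ⊆ R' := by
  classical
  obtain ⟨M, hRM, hM⟩ := (p.everInactive.filter fun R => R ⊂ S).exists_le_maximal
    (Finset.mem_filter.2 ⟨hR, hRS⟩)
  obtain ⟨hM1, hM2⟩ := Finset.mem_filter.1 hM.1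
  exact ⟨M, mem_superVertices.2 ⟨hM1, hM2, fun R' hR' hR'S hMR' =>
    hM.eq_of_le (Finset.mem_filter.2 ⟨hR', hR'S⟩) hMR'⟩, hRM⟩

namespace WellFormed

theorem superVertex_mem_family (h : p.WellFormed) {S R : Finset V} (hR : R ∈ p.superVertices S) :
    R ∈ p.family := h.ever_sub (mem_superVertices.1 hR).1

theorem subset_or_subset (h : p.WellFormed) {S R : Finset V} (hS : S ∈ p.family)
    (hR : R ∈ p.family) {v : V} (hvS : v ∈ S) (hvR : v ∈ R) : S ⊆ R ∨ R ⊆ S := by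
  rcases h.laminar S hS R hR with h1 | h1 | h1
  · exact Or.inl h1
  · exact Or.inr h1
  · exact absurd hvR (Finset.disjoint_left.1 h1 hvS)

theorem superVertices_disjoint (h : p.WellFormed) {S R R' : Finset V}
    (hR : R ∈ p.superVertices S) (hR' : R' ∈ p.superVertices S) (hne : R ≠ R') :
    Disjoint R R' := by
  obtain ⟨h1, h2, h3⟩ := mem_superVertices.1 hR
  obtain ⟨h1', h2', h3'⟩ := mem_superVertices.1 hR'
  rcases h.laminar R (h.ever_sub h1) R' (h.ever_sub h1') with hs | hs | hs
  · exact absurd (h3 R' h1' h2' hs) hne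
  · exact absurd (h3' R h1 h2 hs).symm hne
  · exact hs

theorem disjoint_superUnion_core (h : p.WellFormed) {S C : Finset V} (hS : S ∈ p.family)
    (hC : p.IsCore S C) : Disjoint (p.superUnion S) C := by
  rw [Finset.disjoint_left]
  intro v hv hvC
  obtain ⟨R, hR, hvR⟩ := mem_superUnion.1 hv
  obtain ⟨hR1, hR2, -⟩ := mem_superVertices.1 hR
  refine (h.core_spec hS hC).1 R hR1 hR2 ?_
  rcases h.subset_or_subset (h.comps_sub hC.1) (h.ever_sub hR1) hvC hvR with hs | hs
  · exact hs
  -- If `R ⊆ C`, the core of `R` meets `C`, hence equals `C`, and again `C ⊆ R`.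
  · obtain ⟨D, hD⟩ := h.exists_isCore (h.ever_sub hR1)
    obtain ⟨u, hu⟩ := h.nonempty D (h.comps_sub hD.1)
    rw [← h.comp_eq_of_mem hD.1 hC.1 hu (hs (hD.2.1 hu))]
    exact hD.2.1

/-- A set of the family inside `S` with a core different from that of `S` lies in a
super-vertex. -/
theorem subset_superUnion_of_core_ne (h : p.WellFormed) {S C R D : Finset V} (hS : S ∈ p.family)
    (hC : p.IsCore S C) (hR : R ∈ p.family) (hRS : R ⊆ S) (hD : p.IsCore R D) (hne : D ≠ C) :
    ∃ Q ∈ p.superVertices S, R ⊆ Q := by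
  -- As a non-core component of `S`, `D` lies in a super-vertex `Q'`. If `Q'` were a proper subset
  -- of `R`, it would be an inactive proper subset containing the core of `R`; so laminarity leaves
  -- `R ⊆ Q'`.
  obtain ⟨-, Q, hQ, hQS, hDQ⟩ := (h.core_spec hS hC).2 D hD.1 (hD.2.1.trans hRS) hne
  obtain ⟨Q', hQ', hQQ'⟩ := exists_superVertex hQ hQS
  obtain ⟨u, hu⟩ := h.nonempty D (h.comps_sub hD.1)
  rcases h.subset_or_subset hR (h.superVertex_mem_family hQ') (hD.2.1 hu) (hQQ' (hDQ hu))
    with hs | hs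
  · exact ⟨Q', hQ', hs⟩
  · by_cases he : R ⊆ Q'
    · exact ⟨Q', hQ', he⟩
    · exact absurd (hDQ.trans hQQ')
        ((h.core_spec hR hD).1 Q' (mem_superVertices.1 hQ').1 ⟨hs, he⟩)

end WellFormed

/-- The cores of all sets in the family that contain `v` satisfy `K`. -/
def CoresAt (p : Phase V) (K : Finset V → Prop) (v : V) : Prop :=
  ∀ R ∈ p.family, v ∈ R → ∀ C, p.IsCore R C → K C

/-- The cores of all sets in the family that contain `S` satisfy `K`. -/
def CoresAbove (p : Phase V) (K : Finset V → Prop) (S : Finset V) : Prop :=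
  ∀ R ∈ p.family, S ⊆ R → ∀ C, p.IsCore R C → K C

theorem CoresAt.mono {K K' : Finset V → Prop} (hK : ∀ C, K C → K' C) {v : V}
    (h : p.CoresAt K v) : p.CoresAt K' v := fun R hR hv C hC => hK C (h R hR hv C hC)

theorem CoresAbove.mono {K K' : Finset V → Prop} (hK : ∀ C, K C → K' C) {S : Finset V}
    (h : p.CoresAbove K S) : p.CoresAbove K' S := fun R hR hv C hC => hK C (h R hR hv C hC)

/-- A family set through `v` either contains `S` or lies inside `S` but in no super-vertex, and then
it has the same core as `S`. -/
theorem WellFormed.coresAt_of_notMem_superUnion (h : p.WellFormed) {K : Finset V → Prop}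
    {S : Finset V} (hS : S ∈ p.family) (hK : p.CoresAbove K S) {v : V} (hv : v ∈ S)
    (hv' : v ∉ p.superUnion S) : p.CoresAt K v := by
  intro R hR hvR D hD
  rcases h.subset_or_subset hS hR hv hvR with hs | hs
  · exact hK R hR hs D hD
  · obtain ⟨C, hC⟩ := h.exists_isCore hS
    by_cases hne : D = C
    · rw [hne]; exact hK S hS subset_rfl C hC
    · obtain ⟨Q, hQ, hRQ⟩ := h.subset_superUnion_of_core_ne hS hC hR hs hD hne
      exact absurd (subset_superUnion hQ (hRQ hvR)) hv'

/-- A family set strictly between `R` and `S` lies in no super-vertex, by maximality of `R`, so it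
shares the core of `S`. -/
theorem WellFormed.core_above_superVertex (h : p.WellFormed) {K : Finset V → Prop}
    {S R : Finset V} (hS : S ∈ p.family) (hK : p.CoresAbove K S) (hR : R ∈ p.superVertices S) :
    ∀ Q ∈ p.family, R ⊂ Q → ∀ C, p.IsCore Q C → K C := by
  intro Q hQ hRQ D hD
  obtain ⟨u, hu⟩ := h.nonempty R (h.superVertex_mem_family hR)
  rcases h.subset_or_subset hS hQ ((mem_superVertices.1 hR).2.1.subset hu) (hRQ.subset hu)
    with hs | hs
  · exact hK Q hQ hs D hD
  · obtain ⟨C, hC⟩ := h.exists_isCore hS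
    by_cases hne : D = C
    · rw [hne]; exact hK S hS subset_rfl C hC
    · obtain ⟨R', hR', hQR'⟩ := h.subset_superUnion_of_core_ne hS hC hQ hs hD hne
      have := (mem_superVertices.1 hR).2.2 R' (mem_superVertices.1 hR').1
        (mem_superVertices.1 hR').2.1 (hRQ.subset.trans hQR')
      exact absurd (this ▸ hQR') hRQ.2

theorem IsTerminalPath.mem_cases {S C L X : Finset V} (hX : p.IsTerminalPath I S C L X) {v : V}
    (hv : v ∈ X) : v ∈ L ∨ (v ∈ S ∧ v ∉ p.superUnion S) := by
  rcases hX with ⟨a, rfl, rfl⟩ | ⟨a, b, hab, rfl, w, -, -, rfl⟩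
  · exact Or.inl hv
  · rcases isNode_of_mem_support w (mem_origVertices.1 hv) with hn | ⟨-, he⟩
    · rcases Finset.mem_union.1 hn.1 with h | h
      · refine Or.inr ⟨h, fun h' => ?_⟩
        obtain ⟨R, hR, hvR⟩ := mem_superUnion.1 h'
        exact hn.2 R hR hvR
      · exact Or.inl h
    · exact absurd (Sum.inl_injective he) hab

theorem IsPathToTree.mem_cases {S T : Finset V} {z : V} {t : V ⊕ Finset V}
    {w : (p.auxGraph I S (insert z T)).Walk (.inl z) t} (hw : p.IsPathToTree I S T z t w) {v : V}
    (hv : v ∈ origVertices w) :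
    (v = z ∨ v ∈ T ∨ (v ∈ S ∧ v ∉ p.superUnion S)) ∧ (v ∈ T ∨ v ∉ p.superUnion S) := by
  rcases isNode_of_mem_support w (mem_origVertices.1 hv) with hn | ⟨he, rfl⟩
  · have hv' : v ∉ p.superUnion S := fun h' => by
      obtain ⟨R, hR, hvR⟩ := mem_superUnion.1 h'
      exact hn.2 R hR hvR
    refine ⟨?_, Or.inr hv'⟩
    rcases Finset.mem_union.1 hn.1 with h | h
    · exact Or.inr (Or.inr ⟨h, hv'⟩)
    · rcases Finset.mem_insert.1 h with h | h
      · exact Or.inl h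
      · exact Or.inr (Or.inl h)
  · cases Sum.inl_injective he
    exact ⟨Or.inl rfl, Or.inl hw.2.1⟩

end Phase

/-! ### Invariants of the task stack -/

namespace Task

open Phase

/-- The vertices that the task may add to the phase tree. -/
def region : Task V → Finset V
  | .findSubTree S L => S ∪ L
  | .findSubTreeBody S L => S ∪ L
  | .connectVertex S z => insert z S
  | .addVertices X => X

/-- The set that must not yet have been reached by the phase tree when the task is carried out. -/
def fresh : Task V → Finset V
  | .findSubTree S _ => S
  | .findSubTreeBody S _ => S
  | .connectVertex _ _ => ∅
  | .addVertices _ => ∅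

/-- The set that contains all cores that the task may charge. -/
noncomputable def chargeable (p : Phase V) : Task V → Finset V
  | .findSubTree S _ => S
  | .findSubTreeBody S _ => p.superUnion S
  | .connectVertex S _ => p.superUnion S
  | .addVertices _ => ∅

/-- The task is certain to add `C` to the phase tree. -/
def Provides (p : Phase V) (C : Finset V) : Task V → Prop
  | .findSubTree _ _ => False
  | .findSubTreeBody S _ => p.IsCore S C
  | .connectVertex _ _ => False
  | .addVertices X => C ⊆ X

/-- The invariant of a single task, where `K` holds for the charged sets. -/
def Admissible (p : Phase V) (K : Finset V → Prop) : Task V → Prop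
  | .findSubTree S L => S ∈ p.family ∧ Disjoint L S ∧ (∀ v ∈ L, p.CoresAt K v) ∧
      ∀ R ∈ p.family, S ⊂ R → ∀ C, p.IsCore R C → K C
  | .findSubTreeBody S L => S ∈ p.family ∧ Disjoint L S ∧ (∀ v ∈ L, p.CoresAt K v) ∧
      p.CoresAbove K S
  | .connectVertex S z => S ∈ p.family ∧ p.CoresAt K z ∧ p.CoresAbove K S
  | .addVertices X => ∀ v ∈ X, p.CoresAt K v

theorem Admissible.mono {K K' : Finset V → Prop} (hK : ∀ C, K C → K' C) {t : Task V}
    (h : t.Admissible p K) : t.Admissible p K' := by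
  cases t with
  | findSubTree S L =>
    exact ⟨h.1, h.2.1, fun v hv => (h.2.2.1 v hv).mono hK,
      fun R hR hSR C hC => hK C (h.2.2.2 R hR hSR C hC)⟩
  | findSubTreeBody S L =>
    exact ⟨h.1, h.2.1, fun v hv => (h.2.2.1 v hv).mono hK, h.2.2.2.mono hK⟩
  | connectVertex S z => exact ⟨h.1, h.2.1.mono hK, h.2.2.mono hK⟩
  | addVertices X => exact fun v hv => (h v hv).mono hK

end Task

/-- Some task of the stack will add `C` to the phase tree, and `C` cannot be charged before. -/
def Pending (p : Phase V) (C : Finset V) : List (Task V) → Prop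
  | [] => False
  | t :: l => Disjoint (t.chargeable p) C ∧ (t.Provides p C ∨ Pending p C l)

theorem Pending.append {C : Finset V} {l l' : List (Task V)}
    (hl : ∀ t ∈ l, Disjoint (t.chargeable p) C) (h : Pending p C l') : Pending p C (l ++ l') := by
  induction l with
  | nil => exact h
  | cons t l ih =>
    exact ⟨hl t List.mem_cons_self, Or.inr (ih fun s hs => hl s (List.mem_cons_of_mem _ hs))⟩

/-- The set `C` has been charged. -/
def Charged (calls : List (Call V)) (C : Finset V) : Prop :=
  ∃ k ∈ calls, k.phase.IsCore k.set C

/-- The invariant of the construction of a phase tree, where `K` holds for the charged sets. -/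
structure BuildInvariant (p : Phase V) (T : Finset V) (stack : List (Task V))
    (K : Finset V → Prop) : Prop where
  not_subset_root : ∀ C ∈ p.comps, ¬ C ⊆ p.rootTree
  charged_subset : ∀ C, K C → (∃ D ∈ p.comps, C ⊆ D) ∨ C ⊆ p.rootTree
  exists_new : ∃ v ∈ T, ∀ C ∈ p.comps, v ∉ C
  exists_charged : (∃ C ∈ p.comps, K C) ∨ ∃ S L, Task.findSubTree S L ∈ stack
  fresh : ∀ t ∈ stack, Disjoint t.fresh T
  separated : stack.Pairwise fun s t => Disjoint s.region t.fresh
  pending : ∀ C ∈ p.comps, K C → C ⊆ T ∨ Pending p C stack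
  admissible : ∀ t ∈ stack, t.Admissible p K
  tree : ∀ v ∈ T, p.CoresAt K v

/-! ### Preservation of the invariant by each task -/

namespace BuildInvariant

open Phase

variable {T : Finset V} {stack : List (Task V)} {K : Finset V → Prop}

/-- The newly charged core is owed by the body, which may charge only inside super-vertices of `S`,
and these avoid the core. -/
theorem call (h : p.WellFormed) {S L : Finset V}
    (hi : BuildInvariant p T (.findSubTree S L :: stack) K) {K' : Finset V → Prop}
    (hK' : ∀ C, K' C ↔ K C ∨ p.IsCore S C) :
    BuildInvariant p T (.findSubTreeBody S L :: stack) K' where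
  not_subset_root := hi.not_subset_root
  charged_subset := fun C hC => by
    rcases (hK' C).1 hC with hC | hC
    · exact hi.charged_subset C hC
    · exact Or.inl ⟨C, hC.1, subset_rfl⟩
  exists_new := hi.exists_new
  exists_charged := by
    obtain ⟨C, hC⟩ := h.exists_isCore (hi.admissible _ List.mem_cons_self).1
    exact Or.inl ⟨C, hC.1, (hK' C).2 (Or.inr hC)⟩
  fresh := by
    have := hi.fresh
    rw [List.forall_mem_cons] at this ⊢
    exact this
  separated := by
    have := hi.separated
    rw [List.pairwise_cons] at this ⊢
    exact this
  pending := fun C hC hCK => by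
    have hS := (hi.admissible _ List.mem_cons_self).1
    rcases (hK' C).1 hCK with hCK | hCK
    · rcases hi.pending C hC hCK with h' | ⟨h1, h2⟩
      · exact Or.inl h'
      · exact Or.inr ⟨h1.mono_left (superUnion_subset S), Or.inr (h2.resolve_left id)⟩
    · exact Or.inr ⟨h.disjoint_superUnion_core hS hCK, Or.inl hCK⟩
  admissible := by
    have hmono : ∀ C, K C → K' C := fun C hC => (hK' C).2 (Or.inl hC)
    have := hi.admissible
    rw [List.forall_mem_cons] at this ⊢
    obtain ⟨⟨h1, h2, h3, h4⟩, h5⟩ := this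
    refine ⟨⟨h1, h2, fun v hv => (h3 v hv).mono hmono, fun R hR hSR C hC => ?_⟩,
      fun t ht => (h5 t ht).mono hmono⟩
    by_cases he : S = R
    · exact (hK' C).2 (Or.inr (he ▸ hC))
    · exact hmono C (h4 R hR (lt_of_le_of_ne hSR he) C hC)
  tree := fun v hv => (hi.tree v hv).mono fun C hC => (hK' C).2 (Or.inl hC)

/-- A set is charged only if it has not been charged before. -/
theorem not_charged (h : p.WellFormed) {S L C : Finset V}
    (hi : BuildInvariant p T (.findSubTree S L :: stack) K) (hC : p.IsCore S C) : ¬ K C := by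
  intro hCK
  obtain ⟨v, hv⟩ := h.nonempty C (h.comps_sub hC.1)
  -- Both alternatives separate `C` from `S`: the tree does not meet `S`, and what the top task may
  -- charge, namely anything inside `S`, must avoid a pending `C`.
  rcases hi.pending C hC.1 hCK with h' | ⟨h1, -⟩
  · exact Finset.disjoint_left.1 (hi.fresh _ List.mem_cons_self) (hC.2.1 hv) (h' hv)
  · exact Finset.disjoint_left.1 h1 (hC.2.1 hv) hv

theorem mem_subCalls {X : Finset V} {order : List (Finset V)} {t : Task V} :
    t ∈ subCalls I X order ↔ ∃ R ∈ order, .findSubTree R (X ∩ I.nbhd R) = t := by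
  simp [subCalls]

/-- The calls of `FindSubTree` for super-vertices that `X` avoids do not interfere. -/
theorem pairwise_subCalls (h : p.WellFormed) {S X : Finset V} {order : List (Finset V)}
    (ho : order.Nodup) (hs : ∀ R ∈ order, R ∈ p.superVertices S) (hX : ∀ R ∈ order, Disjoint X R) :
    (subCalls I X order).Pairwise fun s t => Disjoint s.region t.fresh := by
  rw [subCalls, List.pairwise_map]
  refine ho.imp_of_mem fun {R R'} hR hR' hne => ?_
  exact Finset.disjoint_union_left.2 ⟨h.superVertices_disjoint (hs R hR) (hs R' hR') hne,
    (hX R' hR').mono_left Finset.inter_subset_left⟩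

theorem admissible_subCall (h : p.WellFormed) {S X R : Finset V} (hS : S ∈ p.family)
    (hK : p.CoresAbove K S) (hR : R ∈ p.superVertices S) (hX : ∀ v ∈ X, p.CoresAt K v) :
    (Task.findSubTree R (X ∩ I.nbhd R)).Admissible p K := by
  refine ⟨h.superVertex_mem_family hR, ?_, fun v hv => hX v (Finset.mem_inter.1 hv).1,
    h.core_above_superVertex hS hK hR⟩
  rw [Finset.disjoint_left]
  exact fun v hv => I.notMem_of_mem_nbhd (Finset.mem_inter.1 hv).2

theorem body (h : p.WellFormed) {S L C X : Finset V}
    (hi : BuildInvariant p T (.findSubTreeBody S L :: stack) K) (hC : p.IsCore S C)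
    (hX : p.IsTerminalPath I S C L X) {order : List (Finset V)}
    (horder : Enumerates order (p.superNbrs I S X)) {z : V} (hz : z ∈ C) :
    BuildInvariant p (T ∪ X)
      (subCalls I X order ++ [.connectVertex S z, .addVertices C] ++ stack) K := by
  obtain ⟨⟨hS, hLS, hL, hK⟩, hadm⟩ := List.forall_mem_cons.1 hi.admissible
  obtain ⟨hST, hfresh⟩ := List.forall_mem_cons.1 hi.fresh
  obtain ⟨hsep, hpw⟩ := List.pairwise_cons.1 hi.separated
  have hs : ∀ R ∈ order, R ∈ p.superVertices S := fun R hR =>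
    (mem_superNbrs.1 ((horder.2 R).1 hR)).1
  have hsub : ∀ R ∈ order, R ⊆ S := fun R hR => (subset_superUnion (hs R hR)).trans
    (superUnion_subset S)
  have hXok : ∀ v ∈ X, p.CoresAt K v := fun v hv => by
    rcases hX.mem_cases hv with h' | ⟨h1, h2⟩
    · exact hL v h'
    · exact h.coresAt_of_notMem_superUnion hS hK h1 h2
  have hXs : Disjoint X (p.superUnion S) := by
    rw [Finset.disjoint_left]
    intro v hv hv'
    rcases hX.mem_cases hv with h' | ⟨-, h2⟩
    · exact Finset.disjoint_left.1 hLS h' (superUnion_subset S hv')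
    · exact h2 hv'
  have hXsub : X ⊆ S ∪ L := fun v hv => by
    rcases hX.mem_cases hv with h' | ⟨h1, -⟩
    · exact Finset.mem_union_right _ h'
    · exact Finset.mem_union_left _ h1
  have hCok : ∀ v ∈ C, p.CoresAt K v := fun v hv =>
    h.coresAt_of_notMem_superUnion hS hK (hC.2.1 hv)
      (Finset.disjoint_right.1 (h.disjoint_superUnion_core hS hC) hv)
  have hXR : ∀ R ∈ order, Disjoint X R := fun R hR => hXs.mono_right (subset_superUnion (hs R hR))
  refine ⟨hi.not_subset_root, hi.charged_subset, ?_, Or.inl ⟨C, hC.1, hK S hS subset_rfl C hC⟩,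
    ?_, ?_, ?_, ?_, ?_⟩
  · obtain ⟨v, hv, hv'⟩ := hi.exists_new
    exact ⟨v, Finset.mem_union_left _ hv, hv'⟩
  · simp only [List.forall_mem_append, List.forall_mem_cons]
    refine ⟨⟨fun t ht => ?_, Finset.disjoint_empty_left _, Finset.disjoint_empty_left _, by simp⟩,
      fun t ht => ?_⟩
    · obtain ⟨R, hR, rfl⟩ := mem_subCalls.1 ht
      exact Finset.disjoint_union_right.2 ⟨hST.mono_left (hsub R hR), (hXR R hR).symm⟩
    · exact Finset.disjoint_union_right.2 ⟨hfresh t ht, ((hsep t ht).mono_left hXsub).symm⟩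
  · have hreg : ∀ s ∈ subCalls I X order ++ [.connectVertex S z, .addVertices C],
        s.region ⊆ S ∪ L := by
      simp only [List.forall_mem_append, List.forall_mem_cons]
      refine ⟨fun t ht => ?_, ?_, ?_, by simp⟩
      · obtain ⟨R, hR, rfl⟩ := mem_subCalls.1 ht
        exact Finset.union_subset ((hsub R hR).trans Finset.subset_union_left)
          (Finset.inter_subset_left.trans hXsub)
      · exact Finset.insert_subset (Finset.mem_union_left _ (hC.2.1 hz)) Finset.subset_union_left
      · exact hC.2.1.trans Finset.subset_union_left
    rw [List.pairwise_append]
    refine ⟨?_, hpw, fun s hs' t ht => (hsep t ht).mono_left (hreg s hs')⟩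
    rw [List.pairwise_append]
    refine ⟨pairwise_subCalls h horder.1 hs hXR, by simp [Task.fresh], fun s _ t ht => ?_⟩
    simp only [List.mem_cons, List.not_mem_nil, or_false] at ht
    rcases ht with rfl | rfl <;> exact Finset.disjoint_empty_right _
  · intro D hD hDK
    have hch : ∀ t ∈ subCalls I X order, t.chargeable p ⊆ p.superUnion S := fun t ht => by
      obtain ⟨R, hR, rfl⟩ := mem_subCalls.1 ht
      exact subset_superUnion (hs R hR)
    rcases hi.pending D hD hDK with h' | ⟨h1, h2⟩
    · exact Or.inl (h'.trans Finset.subset_union_left)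
    · right
      rw [List.append_assoc]
      refine Pending.append (fun t ht => h1.mono_left (hch t ht)) ?_
      -- If the body owed `D`, then `D = C` by uniqueness of the core, and the final `addVertices C`
      -- pays it; otherwise a later task does.
      refine ⟨h1, Or.inr ⟨Finset.disjoint_empty_left _, ?_⟩⟩
      rcases h2 with h2 | h2
      · exact Or.inl (h.core_unique hS hC h2).subset
      · exact Or.inr h2
  · simp only [List.forall_mem_append, List.forall_mem_cons]
    refine ⟨⟨fun t ht => ?_, ⟨hS, hCok z hz, hK⟩, hCok, by simp⟩, hadm⟩
    obtain ⟨R, hR, rfl⟩ := mem_subCalls.1 ht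
    exact admissible_subCall h hS hK (hs R hR) hXok
  · intro v hv
    rcases Finset.mem_union.1 hv with hv | hv
    · exact hi.tree v hv
    · exact hXok v hv

/-- The path may run into `T`, but `T` is disjoint from all waiting fresh sets. A super-vertex in
which it ends meets `T`, whereas new calls of `FindSubTree` concern super-vertices that avoid `T`,
so the two kinds are disjoint. -/
theorem connect (h : p.WellFormed) {S C : Finset V} {z : V}
    (hi : BuildInvariant p T (.connectVertex S z :: stack) K)
    {t : V ⊕ Finset V} {w : (p.auxGraph I S (insert z T)).Walk (.inl z) t}
    (hw : p.IsMinPathToTree I S C T z t w) {cont : List (Task V)} (hcont : Continuation t w cont)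
    {order : List (Finset V)}
    (horder : Enumerates order (p.freeSuperNbrs I S T (Phase.origVertices w))) :
    BuildInvariant p T (cont ++ [.addVertices (Phase.origVertices w)] ++
      subCalls I (Phase.origVertices w) order ++ stack) K := by
  obtain ⟨⟨hS, hz, hK⟩, hadm⟩ := List.forall_mem_cons.1 hi.admissible
  obtain ⟨-, hfresh⟩ := List.forall_mem_cons.1 hi.fresh
  obtain ⟨hsep, hpw⟩ := List.pairwise_cons.1 hi.separated
  obtain ⟨X, hXdef⟩ : ∃ X, X = Phase.origVertices w := ⟨_, rfl⟩
  rw [← hXdef] at horder ⊢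
  have hX : ∀ v ∈ X, (v = z ∨ v ∈ T ∨ (v ∈ S ∧ v ∉ p.superUnion S)) ∧
      (v ∈ T ∨ v ∉ p.superUnion S) := fun v hv => hw.1.mem_cases (hXdef ▸ hv)
  have hs : ∀ R ∈ order, R ∈ p.superVertices S := fun R hR =>
    (mem_superNbrs.1 (mem_freeSuperNbrs.1 ((horder.2 R).1 hR)).1).1
  have hRT : ∀ R ∈ order, Disjoint R T := fun R hR =>
    (mem_freeSuperNbrs.1 ((horder.2 R).1 hR)).2
  have hsub : ∀ {R}, R ∈ p.superVertices S → R ⊆ S := fun hR => (subset_superUnion hR).trans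
    (superUnion_subset S)
  have hXok : ∀ v ∈ X, p.CoresAt K v := fun v hv => by
    rcases (hX v hv).1 with rfl | h' | ⟨h1, h2⟩
    · exact hz
    · exact hi.tree v h'
    · exact h.coresAt_of_notMem_superUnion hS hK h1 h2
  have hXR : ∀ R ∈ order, Disjoint X R := fun R hR => by
    rw [Finset.disjoint_left]
    intro v hv hvR
    rcases (hX v hv).2 with h' | h'
    · exact Finset.disjoint_left.1 (hRT R hR) hvR h'
    · exact h' (subset_superUnion (hs R hR) hvR)
  have hXsub : X ⊆ insert z S ∪ T := fun v hv => by
    rcases (hX v hv).1 with rfl | h' | ⟨h1, -⟩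
    · simp
    · exact Finset.mem_union_right _ h'
    · exact Finset.mem_union_left _ (Finset.mem_insert_of_mem h1)
  have hc : ∀ t ∈ cont, ∃ R ∈ p.superVertices S, (R ∩ T).Nonempty ∧ ∃ u ∈ X,
      t = .connectVertex R u := by
    intro t' ht'
    cases hcont with
    | vertex v w => simp at ht'
    | super R w u hu =>
      rw [List.mem_singleton] at ht'
      have hR : p.IsNode S (insert z T) (.inr R) := by
        rcases isNode_of_mem_support w w.end_mem_support with hn | ⟨-, he⟩
        · exact hn
        · cases he
      refine ⟨R, hR, hw.1.2.1, u, ?_, ht'⟩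
      rw [hXdef, mem_origVertices, ← hu]
      exact w.getVert_mem_support _
  have hpwc : cont.Pairwise fun s t => Disjoint s.region t.fresh := by
    cases hcont <;> simp
  refine ⟨hi.not_subset_root, hi.charged_subset, hi.exists_new, ?_, ?_, ?_, ?_, ?_, hi.tree⟩
  · obtain ⟨D, hD⟩ := h.exists_isCore hS
    exact Or.inl ⟨D, hD.1, hK S hS subset_rfl D hD⟩
  · simp only [List.forall_mem_append, List.forall_mem_cons]
    refine ⟨⟨⟨fun t ht => ?_, Finset.disjoint_empty_left _, by simp⟩, fun t ht => ?_⟩, hfresh⟩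
    · obtain ⟨R, -, -, u, -, rfl⟩ := hc t ht
      exact Finset.disjoint_empty_left _
    · obtain ⟨R, hR, rfl⟩ := mem_subCalls.1 ht
      exact hRT R hR
  · have hreg : ∀ s ∈ cont ++ [.addVertices X] ++ subCalls I X order,
        s.region ⊆ insert z S ∪ T := by
      simp only [List.forall_mem_append, List.forall_mem_cons]
      refine ⟨⟨fun t ht => ?_, hXsub, by simp⟩, fun t ht => ?_⟩
      · obtain ⟨R, hR, -, u, hu, rfl⟩ := hc t ht
        exact Finset.insert_subset (hXsub hu)
          ((hsub hR).trans ((Finset.subset_insert _ _).trans Finset.subset_union_left))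
      · obtain ⟨R, hR, rfl⟩ := mem_subCalls.1 ht
        exact Finset.union_subset ((hsub (hs R hR)).trans
          ((Finset.subset_insert _ _).trans Finset.subset_union_left))
          (Finset.inter_subset_left.trans hXsub)
    rw [List.pairwise_append]
    refine ⟨?_, hpw, fun s hs' t ht => Disjoint.mono_left (hreg s hs')
      (Finset.disjoint_union_left.2 ⟨hsep t ht, (hfresh t ht).symm⟩)⟩
    rw [List.pairwise_append]
    refine ⟨?_, pairwise_subCalls h horder.1 hs hXR, fun s hs' t ht => ?_⟩
    · rw [List.pairwise_append]
      refine ⟨hpwc, by simp, fun s _ t ht => ?_⟩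
      rw [List.mem_singleton.1 ht]
      exact Finset.disjoint_empty_right _
    · obtain ⟨R, hR, rfl⟩ := mem_subCalls.1 ht
      rcases List.mem_append.1 hs' with hs' | hs'
      · obtain ⟨Q, hQ, ⟨q, hq⟩, u, hu, rfl⟩ := hc s hs'
        refine Finset.disjoint_insert_left.2 ⟨Finset.disjoint_left.1 (hXR R hR) hu,
          h.superVertices_disjoint hQ (hs R hR) ?_⟩
        rintro rfl
        exact Finset.disjoint_left.1 (hRT Q hR) (Finset.mem_inter.1 hq).1 (Finset.mem_inter.1 hq).2
      · rw [List.mem_singleton.1 hs']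
        exact hXR R hR
  · intro D hD hDK
    refine (hi.pending D hD hDK).imp_right fun h' => ?_
    obtain ⟨h1, h2⟩ := h'
    refine Pending.append ?_ (h2.resolve_left id)
    simp only [List.forall_mem_append, List.forall_mem_cons]
    refine ⟨⟨fun t ht => ?_, Finset.disjoint_empty_left _, by simp⟩, fun t ht => ?_⟩
    · obtain ⟨R, hR, -, u, -, rfl⟩ := hc t ht
      exact h1.mono_left ((superUnion_subset R).trans (subset_superUnion hR))
    · obtain ⟨R, hR, rfl⟩ := mem_subCalls.1 ht
      exact h1.mono_left (subset_superUnion (hs R hR))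
  · simp only [List.forall_mem_append, List.forall_mem_cons]
    refine ⟨⟨⟨fun t ht => ?_, hXok, by simp⟩, fun t ht => ?_⟩, hadm⟩
    · obtain ⟨R, hR, ⟨q, hq⟩, u, hu, rfl⟩ := hc t ht
      -- All family sets above `R` contain the tree vertex `q`, so their cores are already charged.
      refine ⟨h.superVertex_mem_family hR, hXok u hu, fun Q hQ hRQ D hD => ?_⟩
      obtain ⟨hqR, hqT⟩ := Finset.mem_inter.1 hq
      exact hi.tree q hqT Q hQ (hRQ hqR) D hD
    · obtain ⟨R, hR, rfl⟩ := mem_subCalls.1 ht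
      exact admissible_subCall h hS hK (hs R hR) hXok

theorem add {X : Finset V} (hi : BuildInvariant p T (.addVertices X :: stack) K) :
    BuildInvariant p (T ∪ X) stack K where
  not_subset_root := hi.not_subset_root
  charged_subset := hi.charged_subset
  exists_new := by
    obtain ⟨v, hv, hv'⟩ := hi.exists_new
    exact ⟨v, Finset.mem_union_left _ hv, hv'⟩
  exists_charged := by
    refine hi.exists_charged.imp_right ?_
    rintro ⟨S, L, hSL⟩
    exact ⟨S, L, by simpa using hSL⟩
  fresh := fun t ht => Finset.disjoint_union_right.2
    ⟨hi.fresh t (List.mem_cons_of_mem _ ht), ((List.pairwise_cons.1 hi.separated).1 t ht).symm⟩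
  separated := (List.pairwise_cons.1 hi.separated).2
  pending := fun C hC hCK => by
    rcases hi.pending C hC hCK with h' | ⟨-, h' | h'⟩
    · exact Or.inl (h'.trans Finset.subset_union_left)
    · exact Or.inl (h'.trans Finset.subset_union_right)
    · exact Or.inr h'
  admissible := fun t ht => hi.admissible t (List.mem_cons_of_mem _ ht)
  tree := fun v hv => by
    rcases Finset.mem_union.1 hv with hv | hv
    · exact hi.tree v hv
    · exact hi.admissible _ List.mem_cons_self v hv

end BuildInvariant

/-! ### Passage between growth, construction and the next phase -/

/-- The invariant of the beginning of a phase and of dual growth, where `K` holds for the charged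
sets. -/
structure CompsInvariant (p : Phase V) (K : Finset V → Prop) : Prop where
  not_subset_root : ∀ C ∈ p.comps, ¬ C ⊆ p.rootTree
  not_charged : ∀ C ∈ p.comps, ¬ K C
  charged_subset : ∀ C, K C → (∃ D ∈ p.comps, C ⊆ D) ∨ C ⊆ p.rootTree

/-- The starting vertex lies in no set of the family, so the condition on its cores is vacuous. The
sets searched are maximal, so nothing in the family lies strictly above them. -/
theorem CompsInvariant.build (h : p.WellFormed) {K : Finset V → Prop} (hi : CompsInvariant p K)
    {v : V} (hv : p.Candidate I v) {order : List (Finset V)}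
    (horder : Enumerates order (p.maxNbrs I v)) :
    BuildInvariant p {v} (order.map fun S => .findSubTree S {v}) K := by
  have hmem : ∀ S ∈ order, S ∈ p.active ∪ p.inactive := fun S hS =>
    (Phase.WellFormed.mem_maxNbrs.1 ((horder.2 S).1 hS)).1
  have hvf : ∀ S ∈ p.family, v ∉ S := fun S hS hvS => by
    obtain ⟨M, hM, hSM⟩ := h.cover S hS
    exact hv.1 M hM (hSM hvS)
  have hvok : p.CoresAt K v := fun R hR hvR => absurd hvR (hvf R hR)
  refine ⟨hi.not_subset_root, hi.charged_subset, ⟨v, by simp, fun C hC => hvf C (h.comps_sub hC)⟩,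
    ?_, ?_, ?_, fun C hC hCK => absurd hCK (hi.not_charged C hC), ?_, ?_⟩
  · obtain ⟨A, hA⟩ := hv.2
    obtain ⟨hA1, hA2⟩ := Phase.WellFormed.mem_activeNbrs.1 hA
    refine Or.inr ⟨A, {v}, List.mem_map.2 ⟨A, (horder.2 A).2 ?_, rfl⟩⟩
    exact Phase.WellFormed.mem_maxNbrs.2 ⟨Finset.mem_union_left _ hA1, hA2⟩
  · intro t ht
    obtain ⟨S, hS, rfl⟩ := List.mem_map.1 ht
    exact Finset.disjoint_singleton_right.2 (hv.1 S (hmem S hS))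
  · rw [List.pairwise_map]
    refine horder.1.imp_of_mem fun {S R} hS hR hne => ?_
    exact Finset.disjoint_union_left.2 ⟨h.max_disj S (hmem S hS) R (hmem R hR) hne,
      Finset.disjoint_singleton_left.2 (hv.1 R (hmem R hR))⟩
  · intro t ht
    obtain ⟨S, hS, rfl⟩ := List.mem_map.1 ht
    refine ⟨h.max_sub_family (hmem S hS), Finset.disjoint_singleton_left.2 (hv.1 S (hmem S hS)),
      by simpa using hvok, fun R hR hSR => ?_⟩
    obtain ⟨M, hM, hRM⟩ := h.cover R hR
    have := h.eq_of_subset hM (hmem S hS) (hSR.subset.trans hRM)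
    exact absurd (this ▸ hRM) hSR.2
  · simpa using hvok

theorem start_invariant {comps : Finset (Finset V)} {T : Finset V} {K : Finset V → Prop}
    (hd : ∀ C ∈ comps, ∀ D ∈ comps, C ≠ D → Disjoint C D)
    (hi : CompsInvariant (Phase.start comps T) K) :
    (Phase.start comps T).WellFormed ∧ (Phase.start comps T).Feasible I := by
  refine ⟨Phase.wellFormed_start T hd fun C hC => ?_, Phase.feasible_start I comps T⟩
  -- An empty component would be contained in the root tree.
  rw [Finset.nonempty_iff_ne_empty]
  rintro rfl
  exact hi.not_subset_root ∅ hC (Finset.empty_subset _)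

theorem BuildInvariant.next (h : p.WellFormed) {T : Finset V} {K : Finset V → Prop}
    (hi : BuildInvariant p T [] K) :
    (p.next I T).WellFormed ∧ (p.next I T).Feasible I ∧ CompsInvariant (p.next I T) K := by
  have hsub : ∀ C ∈ p.comps, K C → C ⊆ T := fun C hC hCK =>
    (hi.pending C hC hCK).resolve_right id
  obtain ⟨C₀, hC₀, hC₀K⟩ : ∃ C ∈ p.comps, K C := hi.exists_charged.resolve_right (by simp)
  obtain ⟨v, hvT, hv⟩ := hi.exists_new
  -- A component is its own core, so if it meets the tree it has been charged, and with no task left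
  -- it must be inside the tree.
  have hdis : ∀ D ∈ p.comps, ¬ D ⊆ T → Disjoint D T := fun D hD hDT => by
    rw [Finset.disjoint_left]
    intro u huD huT
    exact hDT (hsub D hD (hi.tree u huT D (h.comps_sub hD) huD D (h.isCore_self hD)))
  have hTroot : ¬ T ⊆ p.rootTree := fun hT =>
    hi.not_subset_root C₀ hC₀ ((hsub C₀ hC₀ hC₀K).trans hT)
  -- A charged `T` would lie in an old component, excluded by its new vertex, or in the root tree,
  -- excluded by the charged component inside `T`.
  have hTK : ¬ K T := fun hTK => by
    rcases hi.charged_subset T hTK with ⟨D, hD, hTD⟩ | hT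
    · exact hv D hD (hTD hvT)
    · exact hTroot hT
  by_cases hT : (T ∩ I.nbhd p.rootTree).Nonempty
  · rw [Phase.next, if_pos hT]
    have hci : CompsInvariant
        (Phase.start (p.comps.filter fun C => ¬ C ⊆ T) (p.rootTree ∪ T)) K := by
      refine ⟨fun D hD hDT => ?_, fun D hD hDK => ?_, fun C hC => ?_⟩
      · obtain ⟨hD1, hD2⟩ := Finset.mem_filter.1 hD
        exact hi.not_subset_root D hD1 ((hdis D hD1 hD2).left_le_of_le_sup_right hDT)
      · obtain ⟨hD1, hD2⟩ := Finset.mem_filter.1 hD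
        exact hD2 (hsub D hD1 hDK)
      · rcases hi.charged_subset C hC with ⟨D, hD, hCD⟩ | hCr
        · by_cases hDT : D ⊆ T
          · exact Or.inr ((hCD.trans hDT).trans Finset.subset_union_right)
          · exact Or.inl ⟨D, Finset.mem_filter.2 ⟨hD, hDT⟩, hCD⟩
        · exact Or.inr (hCr.trans Finset.subset_union_left)
    obtain ⟨h1, h2⟩ := start_invariant (I := I) (fun C hC D hD hne =>
      h.comps_disj C (Finset.mem_filter.1 hC).1 D (Finset.mem_filter.1 hD).1 hne) hci
    exact ⟨h1, h2, hci⟩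
  · rw [Phase.next, if_neg hT]
    have hci : CompsInvariant
        (Phase.start (insert T (p.comps.filter fun C => ¬ C ⊆ T)) p.rootTree) K := by
      refine ⟨fun D hD => ?_, fun D hD hDK => ?_, fun C hC => ?_⟩
      · rcases Finset.mem_insert.1 hD with rfl | hD
        · exact hTroot
        · exact hi.not_subset_root D (Finset.mem_filter.1 hD).1
      · rcases Finset.mem_insert.1 hD with rfl | hD
        · exact hTK hDK
        · obtain ⟨hD1, hD2⟩ := Finset.mem_filter.1 hD
          exact hD2 (hsub D hD1 hDK)
      · rcases hi.charged_subset C hC with ⟨D, hD, hCD⟩ | hCr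
        · by_cases hDT : D ⊆ T
          · exact Or.inl ⟨T, Finset.mem_insert_self _ _, hCD.trans hDT⟩
          · exact Or.inl ⟨D, Finset.mem_insert_of_mem (Finset.mem_filter.2 ⟨hD, hDT⟩), hCD⟩
        · exact Or.inr hCr
    obtain ⟨h1, h2⟩ := start_invariant (I := I) (fun C hC D hD hne => by
      rcases Finset.mem_insert.1 hC with rfl | hC
      · rcases Finset.mem_insert.1 hD with rfl | hD
        · exact absurd rfl hne
        · exact (hdis D (Finset.mem_filter.1 hD).1 (Finset.mem_filter.1 hD).2).symm
      · rcases Finset.mem_insert.1 hD with rfl | hD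
        · exact hdis C (Finset.mem_filter.1 hC).1 (Finset.mem_filter.1 hC).2
        · exact h.comps_disj C (Finset.mem_filter.1 hC).1 D (Finset.mem_filter.1 hD).1 hne) hci
    exact ⟨h1, h2, hci⟩

/-! ### The first phase and the run as a whole -/

namespace Instance

theorem mem_initialComps {S : Finset V} : S ∈ I.initialComps ↔ I.root ∉ S ∧
    ∃ K : (I.graph.induce I.cheapOrRoot).ConnectedComponent,
      (S : Set V) = Subtype.val '' K.supp := by
  simp [initialComps]

theorem initialComps_disjoint : ∀ C ∈ I.initialComps, ∀ D ∈ I.initialComps, C ≠ D →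
    Disjoint C D := by
  intro C hC D hD hne
  obtain ⟨-, K, hK⟩ := mem_initialComps.1 hC
  obtain ⟨-, K', hK'⟩ := mem_initialComps.1 hD
  rw [Finset.disjoint_left]
  intro v hvC hvD
  rw [← Finset.mem_coe, hK] at hvC
  rw [← Finset.mem_coe, hK'] at hvD
  obtain ⟨x, hx, rfl⟩ := hvC
  obtain ⟨x', hx', he⟩ := hvD
  cases Subtype.val_injective he
  rw [SimpleGraph.ConnectedComponent.mem_supp_iff] at hx hx'
  refine hne (Finset.coe_injective ?_)
  rw [hK, hK', ← hx, ← hx']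

/-- A component sharing a vertex with that of the root would contain the root. -/
theorem not_subset_initialRootTree : ∀ C ∈ I.initialComps, ¬ C ⊆ I.initialRootTree := by
  intro C hC hsub
  obtain ⟨hr, K, hK⟩ := mem_initialComps.1 hC
  obtain ⟨x, hx⟩ := K.nonempty_supp
  have hxC : (x : V) ∈ C := by
    rw [← Finset.mem_coe, hK]
    exact ⟨x, hx, rfl⟩
  have hxr := hsub hxC
  simp only [initialRootTree, Finset.mem_filter, Finset.mem_univ, true_and] at hxr
  obtain ⟨hx', hreach⟩ := hxr
  refine hr ?_
  rw [← Finset.mem_coe, hK]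
  refine ⟨⟨I.root, Or.inl rfl⟩, ?_, rfl⟩
  rw [SimpleGraph.ConnectedComponent.mem_supp_iff] at hx ⊢
  rw [← hx]
  exact SimpleGraph.ConnectedComponent.sound hreach

end Instance

/-- The invariant of the whole algorithm. -/
def Config.Invariant (I : Instance V) (K : Finset V → Prop) : Config V → Prop
  | .growing p => p.WellFormed ∧ p.Feasible I ∧ CompsInvariant p K
  | .building p T stack => p.WellFormed ∧ BuildInvariant p T stack K
  | .finished _ => True

theorem charged_append {calls calls' : List (Call V)} {C : Finset V} :
    Charged (calls ++ calls') C ↔ Charged calls C ∨ Charged calls' C := by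
  simp only [Charged, List.mem_append, or_and_right, exists_or]

theorem timesCharged_eq_zero {calls : List (Call V)} {C : Finset V} (h : ¬ Charged calls C) :
    timesCharged calls C = 0 := by
  simp only [timesCharged, List.countP_eq_zero, decide_eq_true_eq]
  exact fun k hk hC => h ⟨k, hk, hC⟩

theorem Step.invariant {c c' : Config V} {l : List (Call V)} (hs : Step I c l c')
    {calls : List (Call V)} (hi : c.Invariant I (Charged calls)) :
    c'.Invariant I (Charged (calls ++ l)) := by
  cases hs with
  | finish p h => exact trivial
  | deactivate p S hS hmin hle =>
    rw [List.append_nil]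
    obtain ⟨h, hf, hc⟩ := hi
    have h0 := hf.slack_nonneg S (Finset.mem_union_left _ hS)
    exact ⟨(h.grow h0).deactivate, (hf.grow h h0 hle hmin).deactivate, hc.1, hc.2, hc.3⟩
  | merge p v hv hmin hlt htr =>
    rw [List.append_nil]
    obtain ⟨h, hf, hc⟩ := hi
    have h0 := hf.wait_nonneg hv
    exact ⟨(h.grow h0).merge hv htr,
      Phase.Feasible.merge (h.grow h0) (Phase.Feasible.grow h hf h0 hmin fun R hR => (hlt R hR).le)
        hv, hc.1, hc.2, hc.3⟩
  | build p v hv hmin hlt htr order horder =>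
    rw [List.append_nil]
    obtain ⟨h, hf, hc⟩ := hi
    have h' := h.grow (hf.wait_nonneg hv)
    exact ⟨h', CompsInvariant.build h' ⟨hc.1, hc.2, hc.3⟩ hv horder⟩
  | call p T S L stack =>
    exact ⟨hi.1, hi.2.call hi.1 fun C => charged_append.trans (by simp [Charged])⟩
  | body p T S L stack C hC X hX order horder z hz =>
    rw [List.append_nil]
    exact ⟨hi.1, hi.2.body hi.1 hC hX horder hz⟩
  | connect p T S z stack C hC t w hw cont hcont order horder =>
    rw [List.append_nil]
    exact ⟨hi.1, hi.2.connect hi.1 hw hcont horder⟩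
  | add p T X stack =>
    rw [List.append_nil]
    exact ⟨hi.1, hi.2.add⟩
  | endPhase p T =>
    rw [List.append_nil]
    exact hi.2.next hi.1

/-- Only entering `FindSubTree` adds to the list, and then by one call; if that call charges `C`,
the earlier count was zero by `not_charged`. -/
theorem Step.timesCharged_le {c c' : Config V} {l : List (Call V)} (hs : Step I c l c')
    {calls : List (Call V)} (hi : c.Invariant I (Charged calls)) {C : Finset V}
    (hC : timesCharged calls C ≤ 1) : timesCharged (calls ++ l) C ≤ 1 := by
  cases hs with
  | call p T S L stack =>
    by_cases hSC : p.IsCore S C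
    · have h0 := timesCharged_eq_zero (hi.2.not_charged hi.1 hSC)
      rw [timesCharged] at h0 ⊢
      rw [List.countP_append, h0, Nat.zero_add]
      exact List.countP_le_length
    · rw [timesCharged] at hC ⊢
      rw [List.countP_append]
      simpa [hSC] using hC
  | _ => rwa [List.append_nil]

theorem Run.invariant {c : Config V} {calls : List (Call V)} (h : Run I c calls) :
    c.Invariant I (Charged calls) := by
  induction h with
  | init =>
    have hci : CompsInvariant (Phase.start I.initialComps I.initialRootTree)
        (Charged ([] : List (Call V))) := by
      refine ⟨Instance.not_subset_initialRootTree, ?_, ?_⟩ <;> simp [Charged]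
    obtain ⟨h1, h2⟩ := start_invariant (I := I) Instance.initialComps_disjoint hci
    exact ⟨h1, h2, hci⟩
  | step h hs ih => exact hs.invariant ih

end Building

end NWPCST

theorem mainTheorem6 {V : Type*} [Fintype V] [DecidableEq V] (I : NWPCST.Instance V)
    (c : NWPCST.Config V) (calls : List (NWPCST.Call V)) (h : NWPCST.Run I c calls)
    (C : Finset V) : NWPCST.timesCharged calls C ≤ 1 := by
  induction h with
  | init => simp [NWPCST.timesCharged]
  | step h hs ih => exact hs.timesCharged_le h.invariant ih
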